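/- Let $N>0$ and $a\ne 0$ be real, put $(a_1,a_2,a_3)=(a,0,-a)$ and $\omega_j(x)=e^{-N(x^2/2-a_jx)}$ for $j=1,2,3$, and let $n_1,n_2,n_3\ge 1$ be integers with $n=n_1+n_2+n_3$. For nonnegative integers $k_1,k_2,k_3$ let $P_{k_1,k_2,k_3}$ be the monic polynomial of degree $k_1+k_2+k_3$ with $\int_{\mathbb R}P_{k_1,k_2,k_3}(x)x^m\omega_j(x)\,dx=0$ for $0\le m<k_j$, $j=1,2,3$ (multiple Hermite polynomial), let $h^{(j)}_{k_1,k_2,k_3}=\int_{\mathbb R}P_{k_1,k_2,k_3}(x)x^{k_j}\omega_j(x)\,dx$, and set $$c_1=\frac{-2\pi i}{h^{(1)}_{n_1-1,n_2,n_3}},\qquad c_2=\frac{-2\pi i}{h^{(2)}_{n_1,n_2-1,n_3}},\qquad c_3=\frac{-2\pi i}{h^{(3)}_{n_1,n_2,n_3-1}}.$$ Consider the Riemann–Hilbert problem of finding $Y:\mathbb C\setminus\mathbb R\to\mathbb C^{4\times4}$ such that 1. $Y$ is analytic on $\mathbb C\setminus\mathbb R$; 2. for every $x\in\mathbb R$ the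 limits $Y_\pm(x)$ of $Y(z)$ as $z\to x$ from the upper ($+$) and lower ($-$) half-plane exist, and $$Y_+(x)=Y_-(x)\begin{pmatrix}1&\omega_1(x)&\omega_2(x)&\omega_3(x)\\0&1&0&0\\0&0&1&0\\0&0&0&1\end{pmatrix};$$ 3. $Y(z)=\left(I+O(1/z)\right)\operatorname{diag}(z^{n},z^{-n_1},z^{-n_2},z^{-n_3})$ as $z\to\infty$, $z\in\mathbb C\setminus\mathbb R$. This problem has a unique solution $Y$, and the normalized solution $$\Psi_{n_1,n_2,n_3}(z)=\operatorname{diag}\left(1,\tfrac1{c_1},\tfrac1{c_2},\tfrac1{c_3}\right)Y(z)\operatorname{diag}\left(e^{-Nz^2/2},e^{-Na_1z},e^{-Na_2z},e^{-Na_3z}\right)$$ satisfies, for all $z\in\mathbb C\setminus\mathbb R$, the differential equation $$\Psi_{n_1,n_2,n_3}'(z)=N\begin{pmatrix}-z&\frac{n_1}{N}&\frac{n_2}{N}&\frac{n_3}{N}\\-1&-a&0&0\\-1&0&0&0\\-1&0&0&a\end{pmatrix}\Psi_{n_1,n_2,n_3}(z).$$ -/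

import Mathlib

namespace MultipleHermite

noncomputable section

/-- The shifts `(a₁, a₂, a₃) = (a, 0, -a)`. -/
def shift (a : ℝ) : Fin 3 → ℝ := ![a, 0, -a]

/-- The Gaussian weights `ω_j(x) = exp (-N (x² / 2 - a_j x))`. -/
def weight (N a : ℝ) (j : Fin 3) (x : ℝ) : ℝ :=
  Real.exp (-N * (x ^ 2 / 2 - shift a j * x))

/-- `P` is a monic (type II) multiple orthogonal polynomial of multi-index `k`: it is monic of
degree `k₁ + k₂ + k₃`, and `∫ P(x) x^m ω_j(x) dx = 0` for `m < k_j`, `j = 1, 2, 3`. -/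
def IsMultipleOrthogonal (N a : ℝ) (k : Fin 3 → ℕ) (P : Polynomial ℝ) : Prop :=
  P.Monic ∧ P.natDegree = ∑ j, k j ∧
    ∀ j : Fin 3, ∀ m : ℕ, m < k j → ∫ x : ℝ, P.eval x * x ^ m * weight N a j x = 0

open Classical in
/-- The multiple Hermite polynomial `P_{k₁,k₂,k₃}`. -/
def hermitePoly (N a : ℝ) (k : Fin 3 → ℕ) : Polynomial ℝ :=
  if h : ∃ P, IsMultipleOrthogonal N a k P then h.choose else 0

/-- `h^{(j)}_k = ∫ P_k(x) x^{k_j} ω_j(x) dx`. -/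
def hNorm (N a : ℝ) (k : Fin 3 → ℕ) (j : Fin 3) : ℝ :=
  ∫ x : ℝ, (hermitePoly N a k).eval x * x ^ (k j) * weight N a j x

/-- The constants `c_j = -2πi / h^{(j)}_{n - e_j}` (used for `n_j ≥ 1`). -/
def cConst (N a : ℝ) (n : Fin 3 → ℕ) (j : Fin 3) : ℂ :=
  -2 * Real.pi * Complex.I * ((hNorm N a (Function.update n j (n j - 1)) j : ℝ) : ℂ)⁻¹

/-- The jump matrix on the real line. -/
def jumpMatrix (N a : ℝ) (x : ℝ) : Matrix (Fin 4) (Fin 4) ℂ :=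
  !![1, (weight N a 0 x : ℂ), (weight N a 1 x : ℂ), (weight N a 2 x : ℂ);
     0, 1, 0, 0;
     0, 0, 1, 0;
     0, 0, 0, 1]

/-- `Y` solves the `4 × 4` Riemann-Hilbert problem with multi-index `n`. The values of `Y` on the
real line play no role. In `asymptotics`, `E z = Y z * diag (z^n, z^{-n₁}, z^{-n₂}, z^{-n₃})⁻¹`
is compared with the identity, entry by entry, as `z → ∞` in `ℂ \ ℝ`. -/
structure IsRHSolution (N a : ℝ) (n : Fin 3 → ℕ) (Y : ℂ → Matrix (Fin 4) (Fin 4) ℂ) : Prop where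
  analytic : ∀ i j, DifferentiableOn ℂ (fun z => Y z i j) {z : ℂ | z.im ≠ 0}
  jump : ∀ x : ℝ, ∃ Yplus Yminus : Matrix (Fin 4) (Fin 4) ℂ,
    Filter.Tendsto Y (nhdsWithin (x : ℂ) {z : ℂ | 0 < z.im}) (nhds Yplus) ∧
    Filter.Tendsto Y (nhdsWithin (x : ℂ) {z : ℂ | z.im < 0}) (nhds Yminus) ∧
    Yplus = Yminus * jumpMatrix N a x
  asymptotics : ∀ i j,
    Asymptotics.IsBigO (Bornology.cobounded ℂ ⊓ Filter.principal {z : ℂ | z.im ≠ 0})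
      (fun z : ℂ => (Y z * Matrix.diagonal
          ![(z ^ (∑ l, n l))⁻¹, z ^ (n 0), z ^ (n 1), z ^ (n 2)]
        - (1 : Matrix (Fin 4) (Fin 4) ℂ)) i j)
      (fun z : ℂ => z⁻¹)

/-- `Ψ(z) = diag (1, 1/c₁, 1/c₂, 1/c₃) Y(z) diag (e^{-N z²/2}, e^{-N a₁ z}, e^{-N a₂ z},
e^{-N a₃ z})`. -/
def Psi (N a : ℝ) (n : Fin 3 → ℕ) (Y : ℂ → Matrix (Fin 4) (Fin 4) ℂ) (z : ℂ) :
    Matrix (Fin 4) (Fin 4) ℂ :=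
  Matrix.diagonal ![1, 1 / cConst N a n 0, 1 / cConst N a n 1, 1 / cConst N a n 2] * Y z *
    Matrix.diagonal
      ![Complex.exp (-N * (z ^ 2 / 2)), Complex.exp (-N * shift a 0 * z),
        Complex.exp (-N * shift a 1 * z), Complex.exp (-N * shift a 2 * z)]

/-- The coefficient matrix `A(z)`. -/
def coeffMatrix (N a : ℝ) (n : Fin 3 → ℕ) (z : ℂ) : Matrix (Fin 4) (Fin 4) ℂ :=
  !![-z, (n 0 : ℂ) / N, (n 1 : ℂ) / N, (n 2 : ℂ) / N;
     -1, -(a : ℂ), 0, 0;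
     -1, 0, 0, 0;
     -1, 0, 0, (a : ℂ)]

end

end MultipleHermite

/-!
The multiple Hermite polynomial `P_k` is `exp (-D² / (2N)) ∏ (x - a_l) ^ k_l` with `D = d/dx`.
Since `exp (-D² / (2N))` commutes with `D` and conjugates multiplication by `x` into `x - D / N`,
this gives `P_k' = ∑ k_l P_{k - e_l}` and `P_k = (x - a_l) P_{k - e_l} - P_{k - e_l}' / N`. The
rows of the solution `Y` consist, up to the constants `c_l`, of `P_n` and the `P_{n - e_l}`
together with the Cauchy transforms of these polynomials against the three weights.
Differentiating a Cauchy transform in `z` amounts to differentiating the density, and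
orthogonality of `P_n` to the constants makes its Cauchy transforms commute with multiplication by
`x`; the differential equation for every column of `Ψ` is therefore just the pair of relations
above.

In each half-plane the Cauchy transform of a polynomial times a Gaussian is half of the Fourier
inversion integral of that density. The Fourier transform is again a polynomial times a Gaussian, so
both halves extend to entire functions, whose sum is the jump across the real line.

Uniqueness is Liouville's theorem: `Y` has determinant `1`, and the quotient of two solutions has no
jump, is therefore entire, and tends to the identity at infinity.
-/

namespace MultipleHermite

open MeasureTheory Set Filter Topology Polynomial Complex

noncomputable section

/-! ### Polynomials -/

theorem exists_norm_aeval_le_mul_exp_norm {𝕜 A : Type*} [NormedField 𝕜] [NormedRing A]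
    [NormOneClass A] [NormedAlgebra 𝕜 A] (f : 𝕜[X]) :
    ∃ C, 0 ≤ C ∧ ∀ w : A, ‖aeval w f‖ ≤ C * Real.exp ‖w‖ := by
  refine ⟨f.sum fun n c => ‖c‖ * n.factorial,
    Finset.sum_nonneg fun n _ => by positivity, fun w => ?_⟩
  rw [aeval_eq_sum_range, Polynomial.sum_over_range _ (by simp), Finset.sum_mul]
  refine norm_sum_le_of_le _ fun n _ => ?_
  have hpow : ‖w‖ ^ n ≤ n.factorial * Real.exp ‖w‖ := by
    rw [← div_le_iff₀' (by positivity)]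
    exact Real.pow_div_factorial_le_exp _ (norm_nonneg w) n
  calc ‖f.coeff n • w ^ n‖ ≤ ‖f.coeff n‖ * ‖w‖ ^ n := by
        rw [norm_smul]
        gcongr
        exact norm_pow_le w n
    _ ≤ ‖f.coeff n‖ * (n.factorial * Real.exp ‖w‖) := by gcongr
    _ = ‖f.coeff n‖ * n.factorial * Real.exp ‖w‖ := (mul_assoc _ _ _).symm

theorem aeval_mul_inv_pow_sub_coeff_isBigO {𝕜 A : Type*} [NormedField 𝕜] [NormedField A]
    [NormedAlgebra 𝕜 A] {n : ℕ} {P : 𝕜[X]} (hP : P.natDegree ≤ n) :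
    (fun z : A => aeval z P * (z ^ n)⁻¹ - algebraMap 𝕜 A (P.coeff n))
      =O[Bornology.cobounded A] fun z => z⁻¹ := by
  have hinv : Tendsto (fun z : A => z⁻¹) (Bornology.cobounded A) (𝓝 0) := tendsto_inv₀_cobounded
  have hcoeff : (P.reflect n).coeff 0 = P.coeff n := by
    rw [coeff_reflect, revAt_zero]
  have hO : (fun w : A => aeval w (P.reflect n).divX) =O[𝓝 0] fun _ => (1 : A) :=
    ((P.reflect n).divX.continuous_aeval.tendsto 0).isBigO_one A
  refine ((Asymptotics.isBigO_refl (fun z : A => z⁻¹) _).mul (hO.comp_tendsto hinv)).congr' ?_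
    (.of_forall fun z => mul_one _)
  filter_upwards [Bornology.eventually_ne_cobounded (0 : A)] with z hz
  have hdiv : z⁻¹ * aeval z⁻¹ (P.reflect n).divX + algebraMap 𝕜 A (P.coeff n) =
      aeval z⁻¹ (P.reflect n) := by
    conv_rhs => rw [← X_mul_divX_add (P.reflect n), hcoeff]
    rw [map_add, map_mul, aeval_X, aeval_C]
  have hreflect : aeval z⁻¹ (P.reflect n) = aeval z P * (z ^ n)⁻¹ := by
    let _ := invertibleOfNonzero hz
    rw [eq_mul_inv_iff_mul_eq₀ (pow_ne_zero n hz), ← invOf_eq_inv]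
    exact eval₂_reflect_mul_pow (algebraMap 𝕜 A) z n P hP
  rw [← hreflect, ← hdiv, add_sub_cancel_right]
  rfl

theorem polynomial_induction_X_mul {R : Type*} [CommSemiring R] {p : R[X] → Prop}
    (hC : ∀ c, p (C c)) (hadd : ∀ f g, p f → p g → p (f + g)) (hX : ∀ f, p f → p (X * f))
    (f : R[X]) : p f := by
  refine f.induction_on hC hadd fun n c h => ?_
  rw [pow_succ, ← mul_assoc, mul_comm]
  exact hX _ h

section HermiteMap

variable {R : Type*} [CommRing R] (c : R)

/-- The linear map `f ↦ f(X - c D) 1` on polynomials, where `D` is the derivative; it equals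
`exp (-c D² / 2)`. For a Gaussian weight of variance `c` it sends `X ^ n` to the `n`-th monic
Hermite polynomial. -/
def hermiteMap : R[X] →ₗ[R] R[X] :=
  LinearMap.applyₗ 1 ∘ₗ
    (aeval (LinearMap.mulLeft R (X : R[X]) - c • derivative : Module.End R R[X])).toLinearMap

theorem hermiteMap_C (r : R) : hermiteMap c (C r) = C r := by
  simp [hermiteMap, Algebra.algebraMap_eq_smul_one, smul_eq_C_mul]

theorem hermiteMap_X_mul (f : R[X]) :
    hermiteMap c (X * f) = X * hermiteMap c f - c • derivative (hermiteMap c f) := by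
  simp [hermiteMap]

theorem derivative_hermiteMap (f : R[X]) :
    derivative (hermiteMap c f) = hermiteMap c (derivative f) := by
  induction f using polynomial_induction_X_mul with
  | hC r => simp [hermiteMap_C]
  | hadd f g hf hg => simp [hf, hg]
  | hX f hf =>
    simp only [hermiteMap_X_mul, derivative_mul, derivative_X, map_add, map_sub, derivative_smul,
      hf, one_mul]
    ring

theorem hermiteMap_neg_hermiteMap (f : R[X]) : hermiteMap (-c) (hermiteMap c f) = f := by
  induction f using polynomial_induction_X_mul with
  | hC r => simp only [hermiteMap_C]
  | hadd f g hf hg => simp only [map_add, hf, hg]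
  | hX f hf =>
    rw [hermiteMap_X_mul, map_sub, map_smul, hermiteMap_X_mul, ← derivative_hermiteMap, hf,
      neg_smul, sub_neg_eq_add, add_sub_cancel_right]

theorem degree_hermiteMap_X_pow_sub_lt (n : ℕ) :
    (hermiteMap c (X ^ n) - X ^ n).degree < (n : WithBot ℕ) := by
  induction n with
  | zero => simp [← C_1, hermiteMap_C, -map_one]
  | succ n ih =>
    have hle : (hermiteMap c (X ^ n)).degree ≤ n := by
      rw [← sub_add_cancel (hermiteMap c (X ^ n)) (X ^ n)]
      exact (degree_add_le _ _).trans (max_le ih.le (degree_X_pow_le n))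
    have hX : (X * (hermiteMap c (X ^ n) - X ^ n)).degree < ((n + 1 : ℕ) : WithBot ℕ) := by
      refine (degree_lt_iff_coeff_zero _ _).2 fun m hm => ?_
      obtain ⟨m, rfl⟩ := Nat.exists_eq_add_of_le' (Nat.one_le_of_lt hm)
      rw [coeff_X_mul]
      exact (degree_lt_iff_coeff_zero _ _).1 ih m (Nat.le_of_succ_le_succ hm)
    have hD : (c • derivative (hermiteMap c (X ^ n))).degree < ((n + 1 : ℕ) : WithBot ℕ) :=
      ((degree_smul_le _ _).trans (degree_derivative_le.trans hle)).trans_lt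
        (by exact_mod_cast n.lt_succ_self)
    rw [pow_succ', hermiteMap_X_mul, sub_right_comm, ← mul_sub]
    exact (degree_sub_le _ _).trans_lt (max_lt hX hD)

theorem degree_hermiteMap_sub_lt {f : R[X]} (hf : f ≠ 0) :
    (hermiteMap c f - f).degree < f.degree := by
  have hsum : hermiteMap c f - f =
      ∑ i ∈ f.support, f.coeff i • (hermiteMap c (X ^ i) - X ^ i) := by
    conv_lhs => rw [f.as_sum_support_C_mul_X_pow]
    simp only [← smul_eq_C_mul, map_sum, map_smul, smul_sub, Finset.sum_sub_distrib]
  rw [hsum, degree_eq_natDegree hf, ← mem_degreeLT]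
  refine Submodule.sum_mem _ fun i hi => Submodule.smul_mem _ _ (mem_degreeLT.2 ?_)
  exact (degree_hermiteMap_X_pow_sub_lt c i).trans_le
    (by exact_mod_cast le_natDegree_of_mem_supp i hi)

theorem monic_hermiteMap {f : R[X]} (hf : f.Monic) : (hermiteMap c f).Monic := by
  nontriviality R
  rw [← add_sub_cancel f (hermiteMap c f)]
  exact hf.add_of_left (degree_hermiteMap_sub_lt c hf.ne_zero)

theorem natDegree_hermiteMap (f : R[X]) : (hermiteMap c f).natDegree = f.natDegree := by
  rcases eq_or_ne f 0 with rfl | hf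
  · rw [map_zero]
  · conv_lhs => rw [← add_sub_cancel f (hermiteMap c f)]
    exact natDegree_add_eq_left_of_degree_lt (degree_hermiteMap_sub_lt c hf)

end HermiteMap

/-! ### Gaussian moments -/

/-- The Gaussian weight `exp (-N (x² / 2 - α x))`, of variance `1 / N` and centre `α`. -/
def gaussWeight (N α x : ℝ) : ℝ := Real.exp (-N * (x ^ 2 / 2 - α * x))

theorem hasDerivAt_gaussWeight (N α x : ℝ) :
    HasDerivAt (gaussWeight N α) (-N * (x - α) * gaussWeight N α x) x := by
  have h : HasDerivAt (fun x : ℝ => -N * (x ^ 2 / 2 - α * x)) (-N * (x - α)) x := by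
    refine ((((hasDerivAt_id x).pow 2).div_const 2 |>.sub
      ((hasDerivAt_id x).const_mul α)).const_mul (-N)).congr_deriv ?_
    simp
  exact h.exp.congr_deriv (mul_comm _ _)

theorem integrable_exp_mul_abs_sub_mul_sq {β : ℝ} (hβ : 0 < β) (b : ℝ) :
    Integrable fun t : ℝ => Real.exp (b * |t| - β * t ^ 2) := by
  have h (c : ℝ) : Integrable fun t : ℝ => Real.exp (c * t - β * t ^ 2) := by
    refine (integrable_cexp_quadratic (b := β) (by simpa using hβ) c 0).norm.congr
      (.of_forall fun t => ?_)
    simp only [norm_exp]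
    norm_cast
    ring_nf
  refine ((h b).add (h (-b))).mono' (by fun_prop) (.of_forall fun t => ?_)
  rw [Real.norm_of_nonneg (Real.exp_pos _).le, Pi.add_apply]
  rcases abs_choice t with ht | ht <;> rw [ht]
  · linarith [Real.exp_pos (-b * t - β * t ^ 2)]
  · rw [mul_neg, ← neg_mul]
    linarith [Real.exp_pos (b * t - β * t ^ 2)]

theorem integrable_eval_mul_gaussWeight {N : ℝ} (hN : 0 < N) (α : ℝ) (P : ℝ[X]) :
    Integrable fun x => P.eval x * gaussWeight N α x := by
  obtain ⟨C, hC, hP⟩ := exists_norm_aeval_le_mul_exp_norm (A := ℝ) P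
  simp only [coe_aeval_eq_eval, Real.norm_eq_abs] at hP
  refine ((integrable_exp_mul_abs_sub_mul_sq (half_pos hN) (1 + N * |α|)).const_mul C).mono'
    (by unfold gaussWeight; fun_prop) (.of_forall fun x => ?_)
  have hαx : N * (α * x) ≤ N * (|α| * |x|) :=
    mul_le_mul_of_nonneg_left ((le_abs_self _).trans (abs_mul α x).le) hN.le
  calc ‖P.eval x * gaussWeight N α x‖
      ≤ C * Real.exp |x| * Real.exp (N * |α| * |x| - N / 2 * x ^ 2) := by
        rw [norm_mul, gaussWeight, Real.norm_of_nonneg (Real.exp_pos _).le, Real.norm_eq_abs]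
        gcongr
        · exact hP x
        · linarith
    _ = C * Real.exp ((1 + N * |α|) * |x| - N / 2 * x ^ 2) := by
        rw [mul_assoc, ← Real.exp_add]
        ring_nf

/-- The moment functional `P ↦ ∫ P(x) exp (-N (x² / 2 - α x)) dx`. -/
def gaussMoment {N : ℝ} (hN : 0 < N) (α : ℝ) : ℝ[X] →ₗ[ℝ] ℝ where
  toFun P := ∫ x, P.eval x * gaussWeight N α x
  map_add' P Q := by
    simp_rw [eval_add, add_mul]
    exact integral_add (integrable_eval_mul_gaussWeight hN α P)
      (integrable_eval_mul_gaussWeight hN α Q)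
  map_smul' c P := by
    simp_rw [eval_smul, smul_eq_mul, mul_assoc]
    exact integral_const_mul c _

section GaussMoment

variable {N : ℝ} (hN : 0 < N) (α : ℝ)

theorem gaussMoment_apply (P : ℝ[X]) :
    gaussMoment hN α P = ∫ x, P.eval x * gaussWeight N α x := rfl

theorem gaussMoment_one :
    gaussMoment hN α 1 = √(2 * Real.pi / N) * Real.exp (N * α ^ 2 / 2) := by
  have hsq (x : ℝ) : (1 : ℝ[X]).eval x * gaussWeight N α x =
      Real.exp (-(N / 2) * (x - α) ^ 2) * Real.exp (N * α ^ 2 / 2) := by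
    rw [eval_one, one_mul, gaussWeight, ← Real.exp_add]
    ring_nf
  simp_rw [gaussMoment_apply, hsq]
  rw [integral_mul_const, integral_sub_right_eq_self (fun x => Real.exp (-(N / 2) * x ^ 2)) α,
    integral_gaussian]
  congr 2
  field_simp

theorem gaussMoment_one_ne_zero : gaussMoment hN α 1 ≠ 0 := by
  rw [gaussMoment_one]
  positivity

theorem gaussMoment_derivative (P : ℝ[X]) :
    gaussMoment hN α (derivative P) = N * gaussMoment hN α ((X - C α) * P) := by
  have hderiv (x : ℝ) : HasDerivAt (fun x => P.eval x * gaussWeight N α x)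
      ((derivative P - N • ((X - C α) * P)).eval x * gaussWeight N α x) x := by
    refine ((P.hasDerivAt x).mul (hasDerivAt_gaussWeight N α x)).congr_deriv ?_
    simp only [eval_sub, eval_smul, eval_mul, eval_X, eval_C, smul_eq_mul]
    ring
  have hzero := integral_eq_zero_of_hasDerivAt_of_integrable hderiv
    (integrable_eval_mul_gaussWeight hN α _) (integrable_eval_mul_gaussWeight hN α P)
  rw [← gaussMoment_apply hN, map_sub, map_smul, smul_eq_mul] at hzero
  linarith

theorem gaussMoment_hermiteMap_X_sub_C_mul (f q : ℝ[X]) :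
    gaussMoment hN α (hermiteMap N⁻¹ ((X - C α) * f) * q) =
      N⁻¹ * gaussMoment hN α (hermiteMap N⁻¹ f * derivative q) := by
  have hexpand : hermiteMap N⁻¹ ((X - C α) * f) * q = (X - C α) * (hermiteMap N⁻¹ f * q) -
      N⁻¹ • derivative (hermiteMap N⁻¹ f * q) + N⁻¹ • (hermiteMap N⁻¹ f * derivative q) := by
    rw [sub_mul, map_sub, hermiteMap_X_mul, ← smul_eq_C_mul, map_smul, derivative_mul]
    simp only [smul_eq_C_mul]
    ring
  rw [hexpand, map_add, map_sub, map_smul, map_smul, gaussMoment_derivative]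
  simp only [smul_eq_mul]
  field_simp
  ring

theorem gaussMoment_hermiteMap_X_sub_C_pow_mul (m : ℕ) (f q : ℝ[X]) :
    gaussMoment hN α (hermiteMap N⁻¹ ((X - C α) ^ m * f) * q) =
      N⁻¹ ^ m * gaussMoment hN α (hermiteMap N⁻¹ f * derivative^[m] q) := by
  induction m generalizing q with
  | zero => simp
  | succ m ih =>
    rw [pow_succ', mul_assoc, gaussMoment_hermiteMap_X_sub_C_mul, ih,
      Function.iterate_succ_apply]
    ring

theorem gaussMoment_hermiteMap (f : ℝ[X]) :
    gaussMoment hN α (hermiteMap N⁻¹ f) = f.eval α * gaussMoment hN α 1 := by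
  obtain ⟨g, hg⟩ := X_sub_C_dvd_sub_C_eval (a := α) (p := f)
  have hvanish : gaussMoment hN α (hermiteMap N⁻¹ ((X - C α) * g)) = 0 := by
    simpa using gaussMoment_hermiteMap_X_sub_C_mul hN α g 1
  rw [← sub_add_cancel f (C (f.eval α)), hg, map_add, map_add, hvanish, hermiteMap_C, zero_add,
    ← mul_one (C _), ← smul_eq_C_mul, map_smul, smul_eq_mul]
  simp

theorem gaussMoment_eq_eval_mul (P : ℝ[X]) :
    gaussMoment hN α P = (hermiteMap (-N⁻¹) P).eval α * gaussMoment hN α 1 := by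
  rw [← gaussMoment_hermiteMap]
  conv_lhs => rw [← hermiteMap_neg_hermiteMap (-N⁻¹) P, neg_neg]

theorem gaussMoment_hermiteMap_X_sub_C_pow_mul_X_pow_self (m : ℕ) (f : ℝ[X]) :
    gaussMoment hN α (hermiteMap N⁻¹ ((X - C α) ^ m * f) * X ^ m) =
      N⁻¹ ^ m * m.factorial * f.eval α * gaussMoment hN α 1 := by
  rw [gaussMoment_hermiteMap_X_sub_C_pow_mul, iterate_derivative_X_pow_eq_smul,
    Nat.descFactorial_self]
  simp only [tsub_self, pow_zero, mul_smul_comm, mul_one, map_smul, gaussMoment_hermiteMap,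
    smul_eq_mul]
  ring

theorem gaussMoment_hermiteMap_X_sub_C_pow_mul_X_pow_of_lt {m l : ℕ} (h : l < m) (f : ℝ[X]) :
    gaussMoment hN α (hermiteMap N⁻¹ ((X - C α) ^ m * f) * X ^ l) = 0 := by
  rw [gaussMoment_hermiteMap_X_sub_C_pow_mul, iterate_derivative_eq_zero (by simpa using h),
    mul_zero, map_zero, mul_zero]

theorem X_sub_C_pow_dvd_of_gaussMoment_hermiteMap_eq_zero {f : ℝ[X]} {m : ℕ}
    (h : ∀ l < m, gaussMoment hN α (hermiteMap N⁻¹ f * X ^ l) = 0) : (X - C α) ^ m ∣ f := by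
  induction m with
  | zero => simp
  | succ m ih =>
    obtain ⟨g, rfl⟩ := ih fun l hl => h l (hl.trans m.lt_succ_self)
    have hm := h m m.lt_succ_self
    rw [gaussMoment_hermiteMap_X_sub_C_pow_mul_X_pow_self] at hm
    have hroot : g.eval α = 0 := by
      simpa [hN.ne', Nat.factorial_ne_zero, gaussMoment_one_ne_zero hN α] using hm
    rw [pow_succ]
    exact mul_dvd_mul_left _ (dvd_iff_isRoot.2 hroot)

end GaussMoment

/-! ### Multiple Hermite polynomials -/

section NodePoly

variable {R ι : Type*} [CommRing R] [Fintype ι] (b : ι → R) (k : ι → ℕ)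

/-- The polynomial `∏ l, (X - b_l) ^ k_l` with prescribed roots and multiplicities. -/
def nodePoly : R[X] := ∏ l, (X - C (b l)) ^ k l

theorem monic_nodePoly : (nodePoly b k).Monic :=
  monic_prod_of_monic _ _ fun l _ => (monic_X_sub_C (b l)).pow (k l)

theorem natDegree_nodePoly [Nontrivial R] : (nodePoly b k).natDegree = ∑ l, k l := by
  rw [nodePoly, natDegree_prod_of_monic _ _ fun l _ => (monic_X_sub_C (b l)).pow (k l)]
  exact Finset.sum_congr rfl fun l _ => by
    rw [(monic_X_sub_C (b l)).natDegree_pow, natDegree_X_sub_C, mul_one]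

variable [DecidableEq ι] (j : ι)

/-- The cofactor `∏ l ≠ j, (X - b_l) ^ k_l` of the `j`-th node in `nodePoly b k`. -/
def nodeCofactor : R[X] := ∏ l ∈ Finset.univ.erase j, (X - C (b l)) ^ k l

theorem nodePoly_eq_pow_mul : nodePoly b k = (X - C (b j)) ^ k j * nodeCofactor b k j :=
  (Finset.mul_prod_erase _ _ (Finset.mem_univ j)).symm

theorem nodeCofactor_update (m : ℕ) :
    nodeCofactor b (Function.update k j m) j = nodeCofactor b k j :=
  Finset.prod_congr rfl fun _ hl => by rw [Function.update_of_ne (Finset.ne_of_mem_erase hl)]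

theorem nodePoly_update (m : ℕ) :
    nodePoly b (Function.update k j m) = (X - C (b j)) ^ m * nodeCofactor b k j := by
  rw [nodePoly_eq_pow_mul b _ j, nodeCofactor_update, Function.update_self]

variable {k j} in
theorem X_sub_C_mul_nodePoly_update_pred (hj : 1 ≤ k j) :
    (X - C (b j)) * nodePoly b (Function.update k j (k j - 1)) = nodePoly b k := by
  rw [nodePoly_update, ← mul_assoc, mul_pow_sub_one (by lia), ← nodePoly_eq_pow_mul]

theorem derivative_nodePoly :
    derivative (nodePoly b k) = ∑ l, k l • nodePoly b (Function.update k l (k l - 1)) := by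
  rw [nodePoly, derivative_prod_finset]
  refine Finset.sum_congr rfl fun l _ => ?_
  rw [derivative_X_sub_C_pow, nodePoly_update, nodeCofactor, nsmul_eq_mul, map_natCast]
  ring

theorem eval_nodeCofactor_ne_zero [IsDomain R] {b : ι → R} (hb : Function.Injective b) :
    (nodeCofactor b k j).eval (b j) ≠ 0 := by
  rw [nodeCofactor, eval_prod, Finset.prod_ne_zero_iff]
  intro l hl
  rw [eval_pow, eval_sub, eval_X, eval_C]
  exact pow_ne_zero _ (sub_ne_zero.2 (hb.ne (Finset.ne_of_mem_erase hl).symm))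

end NodePoly

section MultiHermite

variable {ι : Type*} [Fintype ι] (N : ℝ) (b : ι → ℝ) (k : ι → ℕ)

/-- The multiple Hermite polynomial of multi-index `k` for the Gaussian weights of variance `1 / N`
centred at the `b_l`: the operator `exp (-D² / (2N))` applied to `∏ l, (X - b_l) ^ k_l`. -/
def multiHermite : ℝ[X] := hermiteMap N⁻¹ (nodePoly b k)

theorem monic_multiHermite : (multiHermite N b k).Monic :=
  monic_hermiteMap _ (monic_nodePoly b k)

theorem natDegree_multiHermite : (multiHermite N b k).natDegree = ∑ l, k l :=
  (natDegree_hermiteMap _ _).trans (natDegree_nodePoly b k)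

theorem derivative_multiHermite [DecidableEq ι] :
    derivative (multiHermite N b k) =
      ∑ l, k l • multiHermite N b (Function.update k l (k l - 1)) := by
  simp only [multiHermite, derivative_hermiteMap, derivative_nodePoly, map_sum, map_nsmul]

variable {k} in
theorem multiHermite_eq_raise [DecidableEq ι] {j : ι} (hj : 1 ≤ k j) :
    multiHermite N b k = (X - C (b j)) * multiHermite N b (Function.update k j (k j - 1)) -
      N⁻¹ • derivative (multiHermite N b (Function.update k j (k j - 1))) := by
  simp only [multiHermite]
  rw [← X_sub_C_mul_nodePoly_update_pred b hj, sub_mul, map_sub, hermiteMap_X_mul,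
    ← smul_eq_C_mul, map_smul, sub_mul, smul_eq_C_mul, smul_eq_C_mul]
  ring

variable {N} (hN : 0 < N)

theorem gaussMoment_multiHermite_mul_X_pow_of_lt {j : ι} {m : ℕ} (hm : m < k j) :
    gaussMoment hN (b j) (multiHermite N b k * X ^ m) = 0 := by
  classical
  rw [multiHermite, nodePoly_eq_pow_mul b k j]
  exact gaussMoment_hermiteMap_X_sub_C_pow_mul_X_pow_of_lt hN _ hm _

variable {b} in
theorem gaussMoment_multiHermite_mul_X_pow_self_ne_zero (hb : Function.Injective b) (j : ι) :
    gaussMoment hN (b j) (multiHermite N b k * X ^ k j) ≠ 0 := by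
  classical
  rw [multiHermite, nodePoly_eq_pow_mul b k j,
    gaussMoment_hermiteMap_X_sub_C_pow_mul_X_pow_self]
  exact mul_ne_zero (mul_ne_zero (by positivity) (eval_nodeCofactor_ne_zero k j hb))
    (gaussMoment_one_ne_zero hN _)

variable {b k} in
theorem eq_multiHermite (hb : Function.Injective b) {P : ℝ[X]} (hmonic : P.Monic)
    (hdeg : P.natDegree = ∑ l, k l)
    (horth : ∀ j, ∀ m < k j, gaussMoment hN (b j) (P * X ^ m) = 0) : P = multiHermite N b k := by
  have hinv : hermiteMap N⁻¹ (hermiteMap (-N⁻¹) P) = P := by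
    simpa only [neg_neg] using hermiteMap_neg_hermiteMap (-N⁻¹) P
  have hdvd : nodePoly b k ∣ hermiteMap (-N⁻¹) P := by
    refine Finset.prod_dvd_of_coprime (fun i _ j _ hij => ?_) fun j _ => ?_
    · exact (pairwise_coprime_X_sub_C hb hij).pow
    · exact X_sub_C_pow_dvd_of_gaussMoment_hermiteMap_eq_zero hN _ fun l hl => by
        rw [hinv, horth j l hl]
  rw [multiHermite, ← eq_of_monic_of_dvd_of_natDegree_le (monic_nodePoly b k)
    (monic_hermiteMap _ hmonic) hdvd (by rw [natDegree_hermiteMap, hdeg, natDegree_nodePoly]),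
    hinv]

end MultiHermite

section HermitePoly

variable {N : ℝ} (hN : 0 < N)

theorem integral_eval_mul_pow_mul_weight (a : ℝ) (P : ℝ[X]) (m : ℕ) (j : Fin 3) :
    ∫ x, P.eval x * x ^ m * weight N a j x = gaussMoment hN (shift a j) (P * X ^ m) := by
  simp only [gaussMoment_apply, eval_mul, eval_pow, eval_X]
  rfl

theorem shift_injective {a : ℝ} (ha : a ≠ 0) : Function.Injective (shift a) := by
  intro i j h
  fin_cases i <;> fin_cases j <;> simp_all [shift, self_eq_neg, neg_eq_self]

theorem isMultipleOrthogonal_multiHermite (hN : 0 < N) (a : ℝ) (k : Fin 3 → ℕ) :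
    IsMultipleOrthogonal N a k (multiHermite N (shift a) k) := by
  refine ⟨monic_multiHermite _ _ _, natDegree_multiHermite _ _ _, fun j m hm => ?_⟩
  rw [integral_eval_mul_pow_mul_weight hN, gaussMoment_multiHermite_mul_X_pow_of_lt _ _ hN hm]

theorem hermitePoly_eq_multiHermite (hN : 0 < N) {a : ℝ} (ha : a ≠ 0) (k : Fin 3 → ℕ) :
    hermitePoly N a k = multiHermite N (shift a) k := by
  have hexists : ∃ P, IsMultipleOrthogonal N a k P :=
    ⟨_, isMultipleOrthogonal_multiHermite hN a k⟩
  rw [hermitePoly, dif_pos hexists]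
  obtain ⟨hmonic, hdeg, horth⟩ := hexists.choose_spec
  refine eq_multiHermite hN (shift_injective ha) hmonic hdeg fun j m hm => ?_
  rw [← integral_eval_mul_pow_mul_weight hN, horth j m hm]

theorem hNorm_eq_gaussMoment {a : ℝ} (ha : a ≠ 0) (k : Fin 3 → ℕ) (j : Fin 3) :
    hNorm N a k j = gaussMoment hN (shift a j) (multiHermite N (shift a) k * X ^ k j) := by
  rw [hNorm, hermitePoly_eq_multiHermite hN ha, integral_eval_mul_pow_mul_weight hN]

end HermitePoly

/-! ### Fourier-Laplace integrals of Gaussian densities -/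

/-- The polynomial part `P' - N (X - α) P` of the derivative of `P(x) exp (-N (x² / 2 - α x))`. -/
def weightedDerivative (N α : ℝ) (P : ℝ[X]) : ℝ[X] := derivative P - N • ((X - C α) * P)

/-- The complex node `α - i t / N` at which the Fourier transform of a Gaussian density of centre
`α` and variance `1 / N` is evaluated. -/
def fourierNode (N α t : ℝ) : ℂ := α - I / N * t

/-- The Fourier transform `(2π)⁻¹ ∫ P(x) exp (-N (x² / 2 - α x)) exp (-i t x) dx` as a function of
`t`, given in closed form: a polynomial, obtained from `P` by the inverse of `hermiteMap N⁻¹`,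
times a Gaussian. -/
def fourierDensity (N α t : ℝ) : ℝ[X] →ₗ[ℝ] ℂ :=
  (exp (N / 2 * fourierNode N α t ^ 2) / √(2 * Real.pi * N) : ℂ) •
    ((aeval (fourierNode N α t)).toLinearMap ∘ₗ hermiteMap (-N⁻¹))

theorem fourierDensity_apply (N α t : ℝ) (P : ℝ[X]) :
    fourierDensity N α t P = exp (N / 2 * fourierNode N α t ^ 2) / √(2 * Real.pi * N) *
      aeval (fourierNode N α t) (hermiteMap (-N⁻¹) P) := rfl

theorem continuous_fourierDensity (N α : ℝ) (P : ℝ[X]) :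
    Continuous fun t => fourierDensity N α t P := by
  simp only [fourierDensity_apply, fourierNode]
  fun_prop

theorem hasDerivAt_fourierDensity {N : ℝ} (hN : N ≠ 0) (α : ℝ) (P : ℝ[X]) (t : ℝ) :
    HasDerivAt (fun t => fourierDensity N α t P) (-I * fourierDensity N α t (X * P)) t := by
  have hnode : HasDerivAt (fourierNode N α) (-(I / N)) t :=
    (((hasDerivAt_id t).ofReal_comp.const_mul (I / N : ℂ)).const_sub (α : ℂ)).congr_deriv
      (by simp)
  have hexp := ((hnode.pow 2).const_mul (N / 2 : ℂ)).cexp.div_const (√(2 * Real.pi * N) : ℂ)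
  have hpoly := ((hermiteMap (-N⁻¹) P).hasDerivAt_aeval (fourierNode N α t)).comp t hnode
  refine (hexp.mul hpoly).congr_deriv ?_
  have hN' : (N : ℂ) ≠ 0 := by exact_mod_cast hN
  simp only [fourierDensity_apply, hermiteMap_X_mul, map_sub, map_smul, map_mul, aeval_X,
    real_smul, Function.comp_apply, Pi.pow_apply]
  push_cast
  field_simp
  ring

theorem fourierDensity_weightedDerivative {N : ℝ} (hN : N ≠ 0) (α t : ℝ) (P : ℝ[X]) :
    fourierDensity N α t (weightedDerivative N α P) = I * t * fourierDensity N α t P := by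
  have hN' : (N : ℂ) ≠ 0 := by exact_mod_cast hN
  simp only [fourierDensity_apply, weightedDerivative, sub_mul, ← smul_eq_C_mul, map_sub,
    map_smul, hermiteMap_X_mul, ← derivative_hermiteMap, map_mul, aeval_X, real_smul]
  generalize exp _ / _ = E
  rw [fourierNode]
  push_cast
  field_simp
  ring

theorem fourierDensity_zero {N : ℝ} (hN : 0 < N) (α : ℝ) (P : ℝ[X]) :
    fourierDensity N α 0 P = gaussMoment hN α P / (2 * Real.pi) := by
  have hsqrt : √(2 * Real.pi / N) = 2 * Real.pi / √(2 * Real.pi * N) := by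
    rw [← Real.sqrt_sq (by positivity : 0 ≤ 2 * Real.pi), ← Real.sqrt_div (sq_nonneg _),
      Real.sqrt_sq (by positivity)]
    congr 1
    field_simp
  have hnode : fourierNode N α 0 = (α : ℝ) := by simp [fourierNode]
  have hexp : exp (N / 2 * (α : ℂ) ^ 2) = (Real.exp (N * α ^ 2 / 2) : ℝ) := by
    push_cast
    ring_nf
  have heval (f : ℝ[X]) : aeval (α : ℂ) f = (f.eval α : ℝ) :=
    aeval_algebraMap_apply_eq_algebraMap_eval α f
  rw [fourierDensity_apply, gaussMoment_eq_eval_mul, gaussMoment_one, hnode, heval, hexp, hsqrt]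
  have hpi : (Real.pi : ℂ) ≠ 0 := by exact_mod_cast Real.pi_ne_zero
  push_cast
  field_simp

theorem norm_exp_fourierNode_sq {N : ℝ} (hN : N ≠ 0) (α t : ℝ) :
    ‖exp (N / 2 * fourierNode N α t ^ 2)‖ =
      Real.exp (N * α ^ 2 / 2) * Real.exp (-(2 * N)⁻¹ * t ^ 2) := by
  have hN' : (N : ℂ) ≠ 0 := by exact_mod_cast hN
  have hre_im : N / 2 * fourierNode N α t ^ 2 =
      (N * α ^ 2 / 2 + -(2 * N)⁻¹ * t ^ 2 : ℝ) + (-(α * t) : ℝ) * I := by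
    rw [fourierNode]
    push_cast
    field_simp
    linear_combination (t : ℂ) ^ 2 * I_sq
  rw [norm_exp, hre_im, add_re, ofReal_re, re_ofReal_mul, I_re, mul_zero, add_zero, Real.exp_add]

theorem exists_norm_fourierDensity_le {N : ℝ} (hN : 0 < N) (α : ℝ) (P : ℝ[X]) :
    ∃ C, ∀ t, ‖fourierDensity N α t P‖ ≤ C * Real.exp (N⁻¹ * |t| - (2 * N)⁻¹ * t ^ 2) := by
  obtain ⟨C, hC, hP⟩ := exists_norm_aeval_le_mul_exp_norm (A := ℂ) (hermiteMap (-N⁻¹) P)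
  refine ⟨Real.exp (N * α ^ 2 / 2) / √(2 * Real.pi * N) * C * Real.exp |α|, fun t => ?_⟩
  have hnode : ‖fourierNode N α t‖ ≤ |α| + N⁻¹ * |t| := by
    refine (norm_sub_le _ _).trans_eq ?_
    simp [abs_of_pos hN]
  calc ‖fourierDensity N α t P‖
      ≤ Real.exp (N * α ^ 2 / 2) * Real.exp (-(2 * N)⁻¹ * t ^ 2) / √(2 * Real.pi * N) *
          (C * Real.exp (|α| + N⁻¹ * |t|)) := by
        rw [fourierDensity_apply, norm_mul, norm_div, norm_exp_fourierNode_sq hN.ne', norm_real,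
          Real.norm_of_nonneg (Real.sqrt_nonneg _)]
        gcongr
        exact (hP _).trans (by gcongr)
    _ = _ := by
        rw [sub_eq_add_neg, Real.exp_add, Real.exp_add, neg_mul]
        ring

/-- The integrand `exp (i t z) φ(t)` of the Fourier-Laplace transform of the density `φ` of `P`. -/
def laplaceIntegrand (N α : ℝ) (z : ℂ) (P : ℝ[X]) (t : ℝ) : ℂ :=
  exp (I * t * z) * fourierDensity N α t P

theorem continuous_laplaceIntegrand (N α : ℝ) (z : ℂ) (P : ℝ[X]) :
    Continuous (laplaceIntegrand N α z P) :=
  (by fun_prop : Continuous fun t : ℝ => exp (I * t * z)).mul (continuous_fourierDensity N α P)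

theorem norm_laplaceIntegrand (N α : ℝ) (z : ℂ) (P : ℝ[X]) (t : ℝ) :
    ‖laplaceIntegrand N α z P t‖ = Real.exp (-(t * z.im)) * ‖fourierDensity N α t P‖ := by
  rw [laplaceIntegrand, norm_mul, Complex.norm_exp]
  simp

theorem exists_norm_laplaceIntegrand_le {N : ℝ} (hN : 0 < N) (α : ℝ) (P : ℝ[X]) :
    ∃ C, ∀ R, ∀ z : ℂ, |z.im| ≤ R → ∀ t, ‖laplaceIntegrand N α z P t‖ ≤
      C * Real.exp ((N⁻¹ + R) * |t| - (2 * N)⁻¹ * t ^ 2) := by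
  obtain ⟨C, hC⟩ := exists_norm_fourierDensity_le hN α P
  refine ⟨C, fun R z hz t => ?_⟩
  have him : -(t * z.im) ≤ R * |t| :=
    calc -(t * z.im) ≤ |t * z.im| := neg_le_abs _
      _ = |z.im| * |t| := by rw [abs_mul, mul_comm]
      _ ≤ R * |t| := by gcongr
  calc ‖laplaceIntegrand N α z P t‖
      ≤ Real.exp (R * |t|) * (C * Real.exp (N⁻¹ * |t| - (2 * N)⁻¹ * t ^ 2)) := by
        rw [norm_laplaceIntegrand]
        gcongr
        exact hC t
    _ = C * Real.exp ((N⁻¹ + R) * |t| - (2 * N)⁻¹ * t ^ 2) := by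
        rw [mul_left_comm, ← Real.exp_add]
        ring_nf

theorem integrable_laplaceIntegrand {N : ℝ} (hN : 0 < N) (α : ℝ) (z : ℂ) (P : ℝ[X]) :
    Integrable (laplaceIntegrand N α z P) := by
  obtain ⟨C, hC⟩ := exists_norm_laplaceIntegrand_le hN α P
  exact ((integrable_exp_mul_abs_sub_mul_sq (by positivity) _).const_mul C).mono'
    (continuous_laplaceIntegrand N α z P).aestronglyMeasurable (.of_forall (hC _ z le_rfl))

theorem hasDerivAt_laplaceIntegrand_left {N : ℝ} (hN : N ≠ 0) (α : ℝ) (z : ℂ) (P : ℝ[X]) (t : ℝ) :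
    HasDerivAt (fun w => laplaceIntegrand N α w P t)
      (laplaceIntegrand N α z (weightedDerivative N α P) t) z := by
  simp only [laplaceIntegrand, fourierDensity_weightedDerivative hN]
  exact (((hasDerivAt_id z).const_mul (I * t)).cexp.mul_const _).congr_deriv (by
    simp only [id, mul_one]
    ring)

theorem hasDerivAt_laplaceIntegrand {N : ℝ} (hN : N ≠ 0) (α : ℝ) (z : ℂ) (P : ℝ[X]) (t : ℝ) :
    HasDerivAt (laplaceIntegrand N α z P)
      (I * (z * laplaceIntegrand N α z P t - laplaceIntegrand N α z (X * P) t)) t := by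
  have hexp : HasDerivAt (fun t : ℝ => exp (I * t * z)) (exp (I * t * z) * (I * z)) t := by
    simpa using (((hasDerivAt_id (t : ℂ)).const_mul I).mul_const z).cexp.comp_ofReal
  exact (hexp.mul (hasDerivAt_fourierDensity hN α P t)).congr_deriv (by
    simp only [laplaceIntegrand]
    ring)

theorem laplaceIntegrand_one (N α : ℝ) (z : ℂ) (t : ℝ) :
    laplaceIntegrand N α z 1 t =
      exp (I * t * z + N / 2 * fourierNode N α t ^ 2) / √(2 * Real.pi * N) := by
  rw [laplaceIntegrand, fourierDensity_apply, ← C_1, hermiteMap_C, aeval_C, map_one, mul_one,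
    ← mul_div_assoc, ← exp_add]

theorem integrable_deriv_laplaceIntegrand {N : ℝ} (hN : 0 < N) (α : ℝ) (z : ℂ) (P : ℝ[X]) :
    Integrable fun t =>
      I * (z * laplaceIntegrand N α z P t - laplaceIntegrand N α z (X * P) t) :=
  (((integrable_laplaceIntegrand hN α z P).const_mul z).sub
    (integrable_laplaceIntegrand hN α z (X * P))).const_mul I

/-- The Fourier-Laplace transform `∫_s exp (i t z) φ(t) dt` over `s` of the density `φ` of `P`. -/
def laplaceIntegral {N : ℝ} (hN : 0 < N) (α : ℝ) (s : Set ℝ) (z : ℂ) : ℝ[X] →ₗ[ℝ] ℂ where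
  toFun P := ∫ t in s, laplaceIntegrand N α z P t
  map_add' P Q := by
    simp only [laplaceIntegrand, map_add, mul_add]
    exact integral_add (integrable_laplaceIntegrand hN α z P).integrableOn
      (integrable_laplaceIntegrand hN α z Q).integrableOn
  map_smul' c P := by
    simp only [laplaceIntegrand, map_smul, mul_smul_comm]
    exact integral_smul c _

section LaplaceIntegral

variable {N : ℝ} (hN : 0 < N) (α : ℝ)

theorem laplaceIntegral_apply (s : Set ℝ) (z : ℂ) (P : ℝ[X]) :
    laplaceIntegral hN α s z P = ∫ t in s, laplaceIntegrand N α z P t := rfl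

theorem laplaceIntegral_Iic_add_Ioi (z : ℂ) (P : ℝ[X]) :
    laplaceIntegral hN α (Iic 0) z P + laplaceIntegral hN α (Ioi 0) z P =
      laplaceIntegral hN α univ z P := by
  have hint := integrable_laplaceIntegrand hN α z P
  simp only [laplaceIntegral_apply]
  rw [← setIntegral_union (Iic_disjoint_Ioi le_rfl) measurableSet_Ioi hint.integrableOn
    hint.integrableOn, Iic_union_Ioi]

theorem hasDerivAt_laplaceIntegral (s : Set ℝ) (P : ℝ[X]) (z : ℂ) :
    HasDerivAt (fun w => laplaceIntegral hN α s w P)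
      (laplaceIntegral hN α s z (weightedDerivative N α P)) z := by
  have him {w : ℂ} (hw : w ∈ Metric.ball z 1) : |w.im| ≤ |z.im| + 1 := by
    have hsub : |w.im - z.im| ≤ 1 := by
      rw [← sub_im]
      exact (abs_im_le_norm _).trans (mem_ball_iff_norm.1 hw).le
    linarith [abs_sub_abs_le_abs_sub w.im z.im]
  obtain ⟨C, hC⟩ := exists_norm_laplaceIntegrand_le hN α (weightedDerivative N α P)
  have hbound := integrable_exp_mul_abs_sub_mul_sq (by positivity : 0 < (2 * N)⁻¹)
    (N⁻¹ + (|z.im| + 1))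
  exact (hasDerivAt_integral_of_dominated_loc_of_deriv_le (μ := volume.restrict s)
    (F := fun w t => laplaceIntegrand N α w P t) (Metric.ball_mem_nhds z one_pos)
    (.of_forall fun w => (continuous_laplaceIntegrand N α w P).aestronglyMeasurable)
    (integrable_laplaceIntegrand hN α z P).integrableOn
    (continuous_laplaceIntegrand N α z _).aestronglyMeasurable
    (.of_forall fun t w hw => hC _ w (him hw) t) (hbound.const_mul C).integrableOn
    (.of_forall fun t w _ => hasDerivAt_laplaceIntegrand_left hN.ne' α w P t)).2

theorem continuous_laplaceIntegral (s : Set ℝ) (P : ℝ[X]) :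
    Continuous fun z => laplaceIntegral hN α s z P :=
  continuous_iff_continuousAt.2 fun z => (hasDerivAt_laplaceIntegral hN α s P z).continuousAt

theorem norm_laplaceIntegral_le {s : Set ℝ} (hs : MeasurableSet s) {z : ℂ}
    (hz : ∀ t ∈ s, 0 ≤ t * z.im) (P : ℝ[X]) :
    ‖laplaceIntegral hN α s z P‖ ≤ ∫ t, ‖fourierDensity N α t P‖ := by
  have hint : Integrable fun t => ‖fourierDensity N α t P‖ := by
    simpa [laplaceIntegrand] using (integrable_laplaceIntegrand hN α 0 P).norm
  calc ‖laplaceIntegral hN α s z P‖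
      ≤ ∫ t in s, ‖laplaceIntegrand N α z P t‖ := norm_integral_le_integral_norm _
    _ ≤ ∫ t in s, ‖fourierDensity N α t P‖ := by
        refine setIntegral_mono_on (integrable_laplaceIntegrand hN α z P).norm.integrableOn
          hint.integrableOn hs fun t ht => ?_
        rw [norm_laplaceIntegrand]
        exact mul_le_of_le_one_left (norm_nonneg _) (Real.exp_le_one_iff.2 (by linarith [hz t ht]))
    _ ≤ ∫ t, ‖fourierDensity N α t P‖ :=
        setIntegral_le_integral hint (.of_forall fun _ => norm_nonneg _)

theorem setIntegral_deriv_laplaceIntegrand (s : Set ℝ) (z : ℂ) (P : ℝ[X]) :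
    ∫ t in s, I * (z * laplaceIntegrand N α z P t - laplaceIntegrand N α z (X * P) t) =
      I * (z * laplaceIntegral hN α s z P - laplaceIntegral hN α s z (X * P)) := by
  rw [integral_const_mul, integral_sub
    ((integrable_laplaceIntegrand hN α z P).const_mul z).integrableOn
    (integrable_laplaceIntegrand hN α z (X * P)).integrableOn, integral_const_mul]
  rfl

theorem mul_laplaceIntegral_univ (z : ℂ) (P : ℝ[X]) :
    z * laplaceIntegral hN α univ z P = laplaceIntegral hN α univ z (X * P) := by
  have hzero := integral_eq_zero_of_hasDerivAt_of_integrable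
    (hasDerivAt_laplaceIntegrand hN.ne' α z P) (integrable_deriv_laplaceIntegrand hN α z P)
    (integrable_laplaceIntegrand hN α z P)
  rw [← setIntegral_univ, setIntegral_deriv_laplaceIntegrand hN] at hzero
  exact sub_eq_zero.1 ((mul_eq_zero_iff_left I_ne_zero).1 hzero)

theorem mul_laplaceIntegral_Ioi (z : ℂ) (P : ℝ[X]) :
    z * laplaceIntegral hN α (Ioi 0) z P = laplaceIntegral hN α (Ioi 0) z (X * P) +
      I * (gaussMoment hN α P / (2 * Real.pi)) := by
  have hderiv (t : ℝ) (_ : t ∈ Ici 0) := hasDerivAt_laplaceIntegrand hN.ne' α z P t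
  have hint := (integrable_deriv_laplaceIntegrand hN α z P).integrableOn (s := Ioi 0)
  have hzero : laplaceIntegrand N α z P 0 = gaussMoment hN α P / (2 * Real.pi) := by
    simp [laplaceIntegrand, fourierDensity_zero hN]
  have hparts := integral_Ioi_of_hasDerivAt_of_tendsto' hderiv hint
    (tendsto_zero_of_hasDerivAt_of_integrableOn_Ioi
      (fun t ht => hderiv t (Ioi_subset_Ici_self ht)) hint
      (integrable_laplaceIntegrand hN α z P).integrableOn)
  rw [setIntegral_deriv_laplaceIntegrand hN, hzero] at hparts
  linear_combination -I * hparts +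
    (z * laplaceIntegral hN α (Ioi 0) z P - laplaceIntegral hN α (Ioi 0) z (X * P)) * I_sq

theorem mul_laplaceIntegral_Iic (z : ℂ) (P : ℝ[X]) :
    z * laplaceIntegral hN α (Iic 0) z P = laplaceIntegral hN α (Iic 0) z (X * P) -
      I * (gaussMoment hN α P / (2 * Real.pi)) := by
  linear_combination mul_laplaceIntegral_univ hN α z P - mul_laplaceIntegral_Ioi hN α z P +
    z * laplaceIntegral_Iic_add_Ioi hN α z P - laplaceIntegral_Iic_add_Ioi hN α z (X * P)

/-- The weight `exp (-N (z² / 2 - α z))` at complex arguments. -/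
def cgaussWeight (N α : ℝ) (z : ℂ) : ℂ := exp (-N * (z ^ 2 / 2 - α * z))

theorem cgaussWeight_ofReal (N α x : ℝ) : cgaussWeight N α x = gaussWeight N α x := by
  simp [cgaussWeight, gaussWeight]

theorem laplaceIntegral_univ_one (z : ℂ) : laplaceIntegral hN α univ z 1 = cgaussWeight N α z := by
  have hN' : (N : ℂ) ≠ 0 := by exact_mod_cast hN.ne'
  have hquad (t : ℝ) : laplaceIntegrand N α z 1 t =
      exp ((-(2 * N)⁻¹ : ℝ) * t ^ 2 + I * (z - α) * t + N * α ^ 2 / 2) /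
        √(2 * Real.pi * N) := by
    rw [laplaceIntegrand_one, fourierNode]
    congr 2
    push_cast
    field_simp
    linear_combination (t : ℂ) ^ 2 * I_sq
  have hsqrt : (Real.pi / -(-(2 * N)⁻¹ : ℝ) : ℂ) ^ (1 / 2 : ℂ) = √(2 * Real.pi * N) := by
    rw [Real.sqrt_eq_rpow, ofReal_cpow (by positivity)]
    push_cast
    field_simp
  have hsqrt_ne : (√(2 * Real.pi * N) : ℂ) ≠ 0 := by
    exact_mod_cast (Real.sqrt_pos.2 (by positivity)).ne'
  rw [laplaceIntegral_apply, setIntegral_univ, integral_congr_ae (.of_forall hquad),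
    integral_div, integral_cexp_quadratic (by simpa using hN), hsqrt,
    mul_div_cancel_left₀ _ hsqrt_ne, cgaussWeight]
  congr 1
  push_cast
  field_simp
  linear_combination 4 * (z - α) ^ 2 * I_sq

theorem laplaceIntegral_univ (z : ℂ) (P : ℝ[X]) :
    laplaceIntegral hN α univ z P = aeval z P * cgaussWeight N α z := by
  induction P using polynomial_induction_X_mul with
  | hC c =>
    rw [← mul_one (C c), ← smul_eq_C_mul, map_smul, map_smul, laplaceIntegral_univ_one, map_one,
      smul_one_mul]
  | hadd P Q hP hQ => rw [map_add, map_add, hP, hQ, add_mul]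
  | hX P hP => rw [← mul_laplaceIntegral_univ, hP, map_mul, aeval_X, mul_assoc]

end LaplaceIntegral

/-! ### The Cauchy transform -/

/-- The Cauchy transform `(2πi)⁻¹ ∫ P(x) exp (-N (x² / 2 - α x)) / (x - z) dx` for `z ∉ ℝ`. In each
half-plane `1 / (x - z)` is a Laplace integral of `exp (-i t x)`, and Fubini's theorem turns
the Cauchy transform into a Fourier-Laplace transform, which extends continuously to the closed
half-plane. -/
def cauchyTransform {N : ℝ} (hN : 0 < N) (α : ℝ) (z : ℂ) : ℝ[X] →ₗ[ℝ] ℂ :=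
  if 0 < z.im then laplaceIntegral hN α (Ioi 0) z else -laplaceIntegral hN α (Iic 0) z

/-- The filter of points of `ℂ \ ℝ` tending to infinity. -/
abbrev offRealAtInfinity : Filter ℂ := Bornology.cobounded ℂ ⊓ 𝓟 {z : ℂ | z.im ≠ 0}

theorem eventually_im_ne_zero : ∀ᶠ z in offRealAtInfinity, z.im ≠ 0 :=
  mem_inf_of_right (mem_principal_self _)

theorem eventually_ne_zero_offRealAtInfinity : ∀ᶠ z in offRealAtInfinity, z ≠ 0 :=
  eventually_im_ne_zero.mono fun z hz h => hz (by rw [h, zero_im])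

section CauchyTransform

variable {N : ℝ} (hN : 0 < N) (α : ℝ)

theorem cauchyTransform_of_im_pos {z : ℂ} (hz : 0 < z.im) :
    cauchyTransform hN α z = laplaceIntegral hN α (Ioi 0) z := if_pos hz

theorem cauchyTransform_of_im_neg {z : ℂ} (hz : z.im < 0) :
    cauchyTransform hN α z = -laplaceIntegral hN α (Iic 0) z := if_neg hz.not_gt

theorem hasDerivAt_cauchyTransform (P : ℝ[X]) {z : ℂ} (hz : z.im ≠ 0) :
    HasDerivAt (fun w => cauchyTransform hN α w P)
      (cauchyTransform hN α z (weightedDerivative N α P)) z := by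
  rcases hz.lt_or_gt with hz | hz
  · have hnhds : ∀ᶠ w in 𝓝 z, w.im < 0 := continuous_im.continuousAt.eventually_lt_const hz
    rw [cauchyTransform_of_im_neg hN α hz]
    exact (hasDerivAt_laplaceIntegral hN α (Iic 0) P z).neg.congr_of_eventuallyEq
      (hnhds.mono fun w hw => DFunLike.congr_fun (cauchyTransform_of_im_neg hN α hw) P)
  · have hnhds : ∀ᶠ w in 𝓝 z, 0 < w.im := continuous_im.continuousAt.eventually_const_lt hz
    rw [cauchyTransform_of_im_pos hN α hz]
    exact (hasDerivAt_laplaceIntegral hN α (Ioi 0) P z).congr_of_eventuallyEq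
      (hnhds.mono fun w hw => DFunLike.congr_fun (cauchyTransform_of_im_pos hN α hw) P)

theorem mul_cauchyTransform (P : ℝ[X]) {z : ℂ} (hz : z.im ≠ 0) :
    z * cauchyTransform hN α z P =
      cauchyTransform hN α z (X * P) + I * (gaussMoment hN α P / (2 * Real.pi)) := by
  rcases hz.lt_or_gt with hz | hz
  · rw [cauchyTransform_of_im_neg hN α hz, LinearMap.neg_apply, LinearMap.neg_apply]
    linear_combination -mul_laplaceIntegral_Iic hN α z P
  · rw [cauchyTransform_of_im_pos hN α hz, mul_laplaceIntegral_Ioi]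

theorem pow_mul_cauchyTransform {k : ℕ} {P : ℝ[X]}
    (horth : ∀ l < k, gaussMoment hN α (P * X ^ l) = 0) {z : ℂ} (hz : z.im ≠ 0) :
    z ^ k * cauchyTransform hN α z P = cauchyTransform hN α z (X ^ k * P) := by
  induction k with
  | zero => simp only [pow_zero, one_mul]
  | succ k ih =>
    have hmoment : gaussMoment hN α (X ^ k * P) = 0 := by
      rw [mul_comm]
      exact horth k k.lt_succ_self
    rw [pow_succ', mul_assoc, ih fun l hl => horth l (hl.trans k.lt_succ_self),
      mul_cauchyTransform hN α _ hz, hmoment, pow_succ', mul_assoc]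
    simp only [ofReal_zero, zero_div, mul_zero, add_zero]

theorem norm_cauchyTransform_le (P : ℝ[X]) {z : ℂ} (hz : z.im ≠ 0) :
    ‖cauchyTransform hN α z P‖ ≤ ∫ t, ‖fourierDensity N α t P‖ := by
  rcases hz.lt_or_gt with hz | hz
  · rw [cauchyTransform_of_im_neg hN α hz, LinearMap.neg_apply, norm_neg]
    exact norm_laplaceIntegral_le hN α measurableSet_Iic
      (fun t ht => mul_nonneg_of_nonpos_of_nonpos ht hz.le) P
  · rw [cauchyTransform_of_im_pos hN α hz]
    exact norm_laplaceIntegral_le hN α measurableSet_Ioi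
      (fun t ht => mul_nonneg (le_of_lt ht) hz.le) P

theorem tendsto_cauchyTransform_upper (P : ℝ[X]) (x : ℝ) :
    Tendsto (fun z => cauchyTransform hN α z P) (𝓝[{z | 0 < z.im}] (x : ℂ))
      (𝓝 (laplaceIntegral hN α (Ioi 0) x P)) := by
  refine (((continuous_laplaceIntegral hN α (Ioi 0) P).tendsto x).mono_left
    nhdsWithin_le_nhds).congr' ?_
  filter_upwards [self_mem_nhdsWithin] with z hz
  exact (DFunLike.congr_fun (cauchyTransform_of_im_pos hN α hz) P).symm

theorem tendsto_cauchyTransform_lower (P : ℝ[X]) (x : ℝ) :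
    Tendsto (fun z => cauchyTransform hN α z P) (𝓝[{z | z.im < 0}] (x : ℂ))
      (𝓝 (-laplaceIntegral hN α (Iic 0) x P)) := by
  refine (((continuous_laplaceIntegral hN α (Iic 0) P).neg.tendsto x).mono_left
    nhdsWithin_le_nhds).congr' ?_
  filter_upwards [self_mem_nhdsWithin] with z hz
  exact (DFunLike.congr_fun (cauchyTransform_of_im_neg hN α hz) P).symm

/-- The Sokhotski-Plemelj formula for the boundary values of the Cauchy transform. -/
theorem laplaceIntegral_Ioi_eq_neg_Iic_add (P : ℝ[X]) (x : ℝ) :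
    laplaceIntegral hN α (Ioi 0) x P =
      -laplaceIntegral hN α (Iic 0) x P + aeval (x : ℂ) P * gaussWeight N α x := by
  rw [← cgaussWeight_ofReal, ← laplaceIntegral_univ hN, ← laplaceIntegral_Iic_add_Ioi]
  ring

theorem cauchyTransform_isBigO_one (P : ℝ[X]) :
    (fun z => cauchyTransform hN α z P) =O[offRealAtInfinity] fun _ => (1 : ℂ) :=
  .of_bound (∫ t, ‖fourierDensity N α t P‖) (eventually_im_ne_zero.mono fun z hz => by
    rw [norm_one, mul_one]
    exact norm_cauchyTransform_le hN α P hz)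

theorem cauchyTransform_isBigO_inv (P : ℝ[X]) :
    (fun z => cauchyTransform hN α z P) =O[offRealAtInfinity] fun z => z⁻¹ := by
  have hmul : (fun z => z * cauchyTransform hN α z P) =O[offRealAtInfinity] fun _ => (1 : ℂ) :=
    ((cauchyTransform_isBigO_one hN α (X * P)).add
      (Asymptotics.isBigO_const_const _ one_ne_zero _)).congr'
      (eventually_im_ne_zero.mono fun z hz => (mul_cauchyTransform hN α P hz).symm) .rfl
  refine ((Asymptotics.isBigO_refl (fun z : ℂ => z⁻¹) _).mul hmul).congr' ?_
    (.of_forall fun z => mul_one _)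
  filter_upwards [eventually_ne_zero_offRealAtInfinity] with z hz
  rw [inv_mul_cancel_left₀ hz]

theorem pow_mul_cauchyTransform_isBigO {k : ℕ} {P : ℝ[X]}
    (horth : ∀ l < k, gaussMoment hN α (P * X ^ l) = 0) :
    (fun z => z ^ k * cauchyTransform hN α z P) =O[offRealAtInfinity] fun z => z⁻¹ :=
  (cauchyTransform_isBigO_inv hN α (X ^ k * P)).congr'
    (eventually_im_ne_zero.mono fun _ hz => (pow_mul_cauchyTransform hN α horth hz).symm) .rfl

theorem pow_succ_mul_cauchyTransform_sub_isBigO {k : ℕ} {P : ℝ[X]}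
    (horth : ∀ l < k, gaussMoment hN α (P * X ^ l) = 0) :
    (fun z => z ^ (k + 1) * cauchyTransform hN α z P -
      I * (gaussMoment hN α (P * X ^ k) / (2 * Real.pi))) =O[offRealAtInfinity] fun z => z⁻¹ := by
  refine (cauchyTransform_isBigO_inv hN α (X * (X ^ k * P))).congr' ?_ .rfl
  filter_upwards [eventually_im_ne_zero] with z hz
  rw [pow_succ', mul_assoc, pow_mul_cauchyTransform hN α horth hz, mul_cauchyTransform hN α _ hz,
    mul_comm P, add_sub_cancel_right]

end CauchyTransform

/-! ### Uniqueness for Riemann-Hilbert problems on the real line -/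

theorem integral_boundary_rect_eq_zero_of_differentiableOn_im_ne_zero {E : Type*}
    [NormedAddCommGroup E] [NormedSpace ℂ E] {G : ℂ → E} (hc : Continuous G)
    (hd : DifferentiableOn ℂ G {z | z.im ≠ 0}) (z w : ℂ) :
    (∫ x : ℝ in z.re..w.re, G (x + z.im * I)) - (∫ x : ℝ in z.re..w.re, G (x + w.im * I)) +
      I • (∫ y : ℝ in z.im..w.im, G (w.re + y * I)) -
      I • (∫ y : ℝ in z.im..w.im, G (z.re + y * I)) = 0 := by
  have hsplit (r : ℝ) : (∫ y : ℝ in z.im..w.im, G (r + y * I)) =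
      (∫ y : ℝ in z.im..0, G (r + y * I)) + ∫ y : ℝ in 0..w.im, G (r + y * I) :=
    (intervalIntegral.integral_add_adjacent_intervals
      (Continuous.intervalIntegrable (by fun_prop) _ _)
      (Continuous.intervalIntegrable (by fun_prop) _ _)).symm
  have hne_left : Ioo (min z.im 0) (max z.im 0) ⊆ {0}ᶜ := fun t ht h0 => by
    rcases le_total z.im 0 with h | h <;> simp_all
  have hne_right : Ioo (min 0 w.im) (max 0 w.im) ⊆ {0}ᶜ := fun t ht h0 => by
    rcases le_total w.im 0 with h | h <;> simp_all
  have hlower := integral_boundary_rect_eq_zero_of_continuousOn_of_differentiableOn G z ⟨w.re, 0⟩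
    hc.continuousOn (hd.mono fun _ hu => hne_left hu.2)
  have hupper := integral_boundary_rect_eq_zero_of_continuousOn_of_differentiableOn G ⟨z.re, 0⟩ w
    hc.continuousOn (hd.mono fun _ hu => hne_right hu.2)
  rw [hsplit, hsplit, smul_add, smul_add]
  linear_combination (norm := module) hlower + hupper

theorem differentiable_of_differentiableOn_im_ne_zero {E : Type*} [NormedAddCommGroup E]
    [NormedSpace ℂ E] [CompleteSpace E] {G : ℂ → E} (hc : Continuous G)
    (hd : DifferentiableOn ℂ G {z | z.im ≠ 0}) : Differentiable ℂ G := by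
  have hcons : IsConservativeOn G univ := fun z w _ => by
    rw [← add_eq_zero_iff_eq_neg, wedgeIntegral_add_wedgeIntegral_eq]
    exact integral_boundary_rect_eq_zero_of_differentiableOn_im_ne_zero hc hd z w
  intro z
  have hball := (hcons.mono (subset_univ (Metric.ball z 1))).isExactOn_ball hc.continuousOn
  exact (hball.differentiableOn Metric.isOpen_ball).differentiableAt
    (Metric.ball_mem_nhds z one_pos)

theorem dense_im_ne_zero : Dense {z : ℂ | z.im ≠ 0} :=
  (dense_compl_singleton (0 : ℝ)).preimage isOpenMap_im

theorem nhdsWithin_im_ne_zero (x : ℂ) :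
    𝓝[{z : ℂ | z.im ≠ 0}] x = 𝓝[{z | 0 < z.im}] x ⊔ 𝓝[{z | z.im < 0}] x := by
  rw [← nhdsWithin_union]
  congr 1
  ext z
  exact ne_iff_lt_or_gt.trans or_comm

theorem exists_differentiable_eqOn_im_ne_zero {E : Type*} [NormedAddCommGroup E]
    [NormedSpace ℂ E] [CompleteSpace E] {g : ℂ → E} (hg : DifferentiableOn ℂ g {z | z.im ≠ 0})
    (hlim : ∀ x : ℝ, ∃ y, Tendsto g (𝓝[{z | 0 < z.im}] (x : ℂ)) (𝓝 y) ∧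
      Tendsto g (𝓝[{z | z.im < 0}] (x : ℂ)) (𝓝 y)) :
    ∃ G : ℂ → E, Differentiable ℂ G ∧ EqOn G g {z | z.im ≠ 0} := by
  have hlim' (z : ℂ) : ∃ y, Tendsto g (𝓝[{z | z.im ≠ 0}] z) (𝓝 y) := by
    by_cases hz : z.im = 0
    · lift z to ℝ using hz
      obtain ⟨y, hupper, hlower⟩ := hlim z
      exact ⟨y, nhdsWithin_im_ne_zero z ▸ hupper.sup hlower⟩
    · exact ⟨g z, hg.continuousOn z hz⟩
  have heq : EqOn (extendFrom {z | z.im ≠ 0} g) g {z | z.im ≠ 0} := fun z hz =>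
    extendFrom_eq (subset_closure hz) (hg.continuousOn z hz)
  exact ⟨_, differentiable_of_differentiableOn_im_ne_zero
    (continuous_extendFrom dense_im_ne_zero hlim') (hg.congr heq), heq⟩

theorem tendsto_cobounded_of_tendsto_offRealAtInfinity {E : Type*} [TopologicalSpace E]
    [RegularSpace E] {G : ℂ → E} {c : E} (hG : Continuous G)
    (hlim : Tendsto G offRealAtInfinity (𝓝 c)) : Tendsto G (Bornology.cobounded ℂ) (𝓝 c) := by
  refine (closed_nhds_basis c).tendsto_right_iff.2 fun s ⟨hs, hclosed⟩ => ?_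
  have hoff := hlim.eventually hs
  rw [eventually_inf_principal,
    (Metric.hasBasis_cobounded_compl_closedBall (0 : ℂ)).eventually_iff] at hoff
  obtain ⟨r, -, hr⟩ := hoff
  refine (Metric.hasBasis_cobounded_compl_closedBall (0 : ℂ)).eventually_iff.2
    ⟨r, trivial, fun w hw => ?_⟩
  have hmem : w ∈ closure ((Metric.closedBall (0 : ℂ) r)ᶜ ∩ {z | z.im ≠ 0}) :=
    dense_im_ne_zero.open_subset_closure_inter Metric.isClosed_closedBall.isOpen_compl hw
  exact closure_minimal (fun u hu => hr hu.1 hu.2) (hclosed.preimage hG) hmem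

theorem eq_of_tendsto_offRealAtInfinity {E : Type*} [NormedAddCommGroup E] [NormedSpace ℂ E]
    [CompleteSpace E] {g : ℂ → E} {c : E} (hg : DifferentiableOn ℂ g {z | z.im ≠ 0})
    (hlim : ∀ x : ℝ, ∃ y, Tendsto g (𝓝[{z | 0 < z.im}] (x : ℂ)) (𝓝 y) ∧
      Tendsto g (𝓝[{z | z.im < 0}] (x : ℂ)) (𝓝 y))
    (hinf : Tendsto g offRealAtInfinity (𝓝 c)) {z : ℂ} (hz : z.im ≠ 0) : g z = c := by
  obtain ⟨G, hG, heq⟩ := exists_differentiable_eqOn_im_ne_zero hg hlim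
  have hGinf : Tendsto G offRealAtInfinity (𝓝 c) :=
    hinf.congr' (eventually_im_ne_zero.mono fun w hw => (heq hw).symm)
  rw [← heq hz]
  refine hG.apply_eq_of_tendsto_cocompact z ?_
  rw [← Metric.cobounded_eq_cocompact]
  exact tendsto_cobounded_of_tendsto_offRealAtInfinity hG.continuous hGinf

section DifferentiableOn

variable {m : Type*} [Fintype m] [DecidableEq m] {Y : ℂ → Matrix m m ℂ} {s : Set ℂ}

theorem differentiableOn_det (h : ∀ i j, DifferentiableOn ℂ (fun z => Y z i j) s) :
    DifferentiableOn ℂ (fun z => (Y z).det) s := by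
  simp_rw [Matrix.det_apply']
  exact DifferentiableOn.fun_sum fun σ _ => (differentiableOn_const _).mul
    (DifferentiableOn.fun_finsetProd fun i _ => h (σ i) i)

theorem differentiableOn_adjugate (h : ∀ i j, DifferentiableOn ℂ (fun z => Y z i j) s) (i j : m) :
    DifferentiableOn ℂ (fun z => (Y z).adjugate i j) s := by
  simp_rw [Matrix.adjugate_apply]
  refine differentiableOn_det fun k l => ?_
  obtain rfl | hk := eq_or_ne k j
  · simp_rw [Matrix.updateRow_self]
    exact differentiableOn_const _
  · simp_rw [Matrix.updateRow_ne hk]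
    exact h k l

end DifferentiableOn

theorem mul_mul_adjugate_mul_cancel {m R : Type*} [Fintype m] [DecidableEq m] [CommRing R]
    (A B : Matrix m m R) {J : Matrix m m R} (hJ : J.det = 1) :
    A * J * (B * J).adjugate = A * B.adjugate := by
  rw [Matrix.adjugate_mul_distrib, Matrix.mul_assoc, ← Matrix.mul_assoc J, Matrix.mul_adjugate, hJ,
    one_smul, Matrix.one_mul]

/-- `Y` solves the Riemann-Hilbert problem on the real line with jump matrix `J`, normalised by
`Y z * D z → 1` at infinity. -/
structure SolvesRHProblem {m : Type*} [Fintype m] [DecidableEq m] (J : ℝ → Matrix m m ℂ)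
    (D Y : ℂ → Matrix m m ℂ) : Prop where
  differentiableOn : ∀ i j, DifferentiableOn ℂ (fun z => Y z i j) {z | z.im ≠ 0}
  jump : ∀ x : ℝ, ∃ U V, Tendsto Y (𝓝[{z | 0 < z.im}] (x : ℂ)) (𝓝 U) ∧
    Tendsto Y (𝓝[{z | z.im < 0}] (x : ℂ)) (𝓝 V) ∧ U = V * J x
  tendsto : Tendsto (fun z => Y z * D z) offRealAtInfinity (𝓝 1)

namespace SolvesRHProblem

variable {m : Type*} [Fintype m] [DecidableEq m] {J : ℝ → Matrix m m ℂ}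
  {D Y Y' : ℂ → Matrix m m ℂ}

theorem det_eq_one (h : SolvesRHProblem J D Y) (hJ : ∀ x, (J x).det = 1)
    (hD : ∀ᶠ z in offRealAtInfinity, (D z).det = 1) {z : ℂ} (hz : z.im ≠ 0) :
    (Y z).det = 1 := by
  have hcont : Continuous (Matrix.det : Matrix m m ℂ → ℂ) := continuous_id.matrix_det
  refine eq_of_tendsto_offRealAtInfinity (g := fun z => (Y z).det)
    (differentiableOn_det h.differentiableOn) (fun x => ?_) ?_ hz
  · obtain ⟨U, V, hU, hV, rfl⟩ := h.jump x
    have hdet : (V * J x).det = V.det := by rw [Matrix.det_mul, hJ, mul_one]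
    exact ⟨V.det, hdet ▸ (hcont.tendsto _).comp hU, (hcont.tendsto _).comp hV⟩
  · have hlim := (hcont.tendsto _).comp h.tendsto
    rw [Matrix.det_one] at hlim
    refine hlim.congr' ?_
    filter_upwards [hD] with w hw
    rw [Function.comp_apply, Matrix.det_mul, hw, mul_one]

/-- The quotient of two solutions is entire and tends to the identity matrix. -/
theorem mul_adjugate_eq_one (h : SolvesRHProblem J D Y) (h' : SolvesRHProblem J D Y')
    (hJ : ∀ x, (J x).det = 1) (hD : ∀ᶠ z in offRealAtInfinity, (D z).det = 1) {z : ℂ}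
    (hz : z.im ≠ 0) : Y' z * (Y z).adjugate = 1 := by
  have hcont (i j : m) : Continuous fun p : Matrix m m ℂ × Matrix m m ℂ =>
      (p.1 * p.2.adjugate) i j :=
    (continuous_fst.matrix_mul continuous_snd.matrix_adjugate).matrix_elem i j
  ext i j
  refine eq_of_tendsto_offRealAtInfinity (g := fun z => (Y' z * (Y z).adjugate) i j) ?_
    (fun x => ?_) ?_ hz
  · simp_rw [Matrix.mul_apply]
    exact DifferentiableOn.fun_sum fun k _ => (h'.differentiableOn i k).mul
      (differentiableOn_adjugate h.differentiableOn k j)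
  · obtain ⟨U, V, hU, hV, rfl⟩ := h.jump x
    obtain ⟨U', V', hU', hV', rfl⟩ := h'.jump x
    refine ⟨(V' * V.adjugate) i j, ?_, ((hcont i j).tendsto _).comp (hV'.prodMk_nhds hV)⟩
    rw [← mul_mul_adjugate_mul_cancel V' V (hJ x)]
    exact ((hcont i j).tendsto _).comp (hU'.prodMk_nhds hU)
  · have hlim := ((hcont i j).tendsto _).comp (h'.tendsto.prodMk_nhds h.tendsto)
    rw [Matrix.adjugate_one, mul_one] at hlim
    refine hlim.congr' ?_
    filter_upwards [hD] with w hw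
    rw [Function.comp_apply, mul_mul_adjugate_mul_cancel _ _ hw]

theorem eq (h : SolvesRHProblem J D Y) (h' : SolvesRHProblem J D Y') (hJ : ∀ x, (J x).det = 1)
    (hD : ∀ᶠ z in offRealAtInfinity, (D z).det = 1) {z : ℂ} (hz : z.im ≠ 0) : Y' z = Y z :=
  calc Y' z = Y' z * ((Y z).adjugate * Y z) := by
        rw [Matrix.adjugate_mul, h.det_eq_one hJ hD hz, one_smul, mul_one]
    _ = Y z := by rw [← mul_assoc, h.mul_adjugate_eq_one h' hJ hD hz, one_mul]

end SolvesRHProblem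

/-- `diag (z^n, z^{-n₁}, z^{-n₂}, z^{-n₃})⁻¹`. -/
def asymptoticDiagonal (n : Fin 3 → ℕ) (z : ℂ) : Matrix (Fin 4) (Fin 4) ℂ :=
  Matrix.diagonal ![(z ^ (∑ l, n l))⁻¹, z ^ (n 0), z ^ (n 1), z ^ (n 2)]

theorem det_asymptoticDiagonal (n : Fin 3 → ℕ) {z : ℂ} (hz : z ≠ 0) :
    (asymptoticDiagonal n z).det = 1 := by
  rw [asymptoticDiagonal, Matrix.det_diagonal, Fin.prod_univ_four, Fin.sum_univ_three, pow_add,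
    pow_add]
  simp only [Matrix.cons_val]
  field_simp

theorem det_jumpMatrix (N a x : ℝ) : (jumpMatrix N a x).det = 1 := by
  rw [Matrix.det_of_isUpperTriangular]
  · simp [Fin.prod_univ_succ, jumpMatrix]
  · intro i j h
    fin_cases i <;> fin_cases j <;> simp_all [jumpMatrix]

theorem IsRHSolution.solvesRHProblem {N a : ℝ} {n : Fin 3 → ℕ} {Y : ℂ → Matrix (Fin 4) (Fin 4) ℂ}
    (h : IsRHSolution N a n Y) :
    SolvesRHProblem (jumpMatrix N a) (asymptoticDiagonal n) Y where
  differentiableOn := h.analytic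
  jump := h.jump
  tendsto := by
    refine tendsto_pi_nhds.2 fun i => tendsto_pi_nhds.2 fun j => ?_
    have hlim := (h.asymptotics i j).trans_tendsto
      ((tendsto_inv₀_cobounded (α := ℂ)).mono_left inf_le_left)
    simpa [asymptoticDiagonal] using hlim.add_const ((1 : Matrix (Fin 4) (Fin 4) ℂ) i j)

theorem IsRHSolution.eq {N a : ℝ} {n : Fin 3 → ℕ} {Y Y' : ℂ → Matrix (Fin 4) (Fin 4) ℂ}
    (h : IsRHSolution N a n Y) (h' : IsRHSolution N a n Y') {z : ℂ} (hz : z.im ≠ 0) :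
    Y' z = Y z :=
  h.solvesRHProblem.eq h'.solvesRHProblem (det_jumpMatrix N a)
    (eventually_ne_zero_offRealAtInfinity.mono fun _ => det_asymptoticDiagonal n) hz

/-! ### The solution and its differential equation -/

section Rows

/-- The multi-indices `n, n - e₁, n - e₂, n - e₃` of the four rows of the solution. -/
def rowIndex (n : Fin 3 → ℕ) : Fin 4 → Fin 3 → ℕ :=
  Fin.cons n fun l => Function.update n l (n l - 1)

/-- The constants `1, c₁, c₂, c₃` scaling the four rows of the solution. -/
def rowScale (N a : ℝ) (n : Fin 3 → ℕ) : Fin 4 → ℂ := Fin.cons 1 (cConst N a n)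

/-- The multiple Hermite polynomials generating the four rows of the solution. -/
def rowPoly (N a : ℝ) (n : Fin 3 → ℕ) (i : Fin 4) : ℝ[X] := multiHermite N (shift a) (rowIndex n i)

variable (N a : ℝ) (n : Fin 3 → ℕ)

theorem rowIndex_succ_self (l : Fin 3) : rowIndex n l.succ l = n l - 1 := Function.update_self ..

theorem rowIndex_of_ne {i : Fin 4} {l : Fin 3} (h : i ≠ l.succ) : rowIndex n i l = n l := by
  cases i using Fin.cases with
  | zero => rfl
  | succ m => exact Function.update_of_ne (fun hlm => h (congrArg Fin.succ hlm.symm)) ..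

theorem natDegree_rowPoly_zero : (rowPoly N a n 0).natDegree = ∑ l, n l :=
  natDegree_multiHermite N (shift a) n

variable {n} in
theorem natDegree_rowPoly_succ_lt {l : Fin 3} (hl : 1 ≤ n l) :
    (rowPoly N a n l.succ).natDegree < ∑ l, n l := by
  refine (natDegree_multiHermite N (shift a) _).trans_lt
    (Finset.sum_lt_sum (fun m _ => ?_) ⟨l, Finset.mem_univ l, ?_⟩)
  · obtain h | h := eq_or_ne l.succ m.succ
    · rw [← Fin.succ_injective _ h, rowIndex_succ_self]
      exact Nat.sub_le _ _
    · exact (rowIndex_of_ne n h).le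
  · rw [rowIndex_succ_self]
    exact Nat.sub_one_lt_of_lt hl

theorem derivative_rowPoly_zero :
    derivative (rowPoly N a n 0) = ∑ l, n l • rowPoly N a n (Fin.succ l) :=
  derivative_multiHermite N (shift a) n

variable {N n} in
theorem weightedDerivative_rowPoly_succ (hN : N ≠ 0) {l : Fin 3} (hl : 1 ≤ n l) :
    weightedDerivative N 0 (rowPoly N a n l.succ) =
      -N • (rowPoly N a n 0 + shift a l • rowPoly N a n l.succ) := by
  have hraise : rowPoly N a n 0 = (X - C (shift a l)) * rowPoly N a n l.succ -
      N⁻¹ • derivative (rowPoly N a n l.succ) := multiHermite_eq_raise N (shift a) hl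
  rw [hraise, sub_mul, ← smul_eq_C_mul, weightedDerivative, map_zero, sub_zero, sub_add_eq_add_sub,
    sub_add_cancel, smul_sub, smul_smul, neg_mul, mul_inv_cancel₀ hN]
  module

variable {N} (hN : 0 < N)

theorem gaussMoment_rowPoly_mul_X_pow {i : Fin 4} {l : Fin 3} {m : ℕ} (hm : m < rowIndex n i l) :
    gaussMoment hN (shift a l) (rowPoly N a n i * X ^ m) = 0 :=
  gaussMoment_multiHermite_mul_X_pow_of_lt (shift a) _ hN hm

variable {a} in
theorem cConst_mul (ha : a ≠ 0) (l : Fin 3) :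
    cConst N a n l * (I * (gaussMoment hN (shift a l) (rowPoly N a n l.succ * X ^ (n l - 1)) /
      (2 * Real.pi))) = 1 := by
  have hnorm : hNorm N a (Function.update n l (n l - 1)) l =
      gaussMoment hN (shift a l) (rowPoly N a n l.succ * X ^ (n l - 1)) := by
    rw [hNorm_eq_gaussMoment hN ha, Function.update_self]
    rfl
  have hne : gaussMoment hN (shift a l) (rowPoly N a n l.succ * X ^ (n l - 1)) ≠ 0 := by
    rw [← rowIndex_succ_self]
    exact gaussMoment_multiHermite_mul_X_pow_self_ne_zero _ hN (shift_injective ha) l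
  rw [cConst, hnorm]
  have hpi : (Real.pi : ℂ) ≠ 0 := ofReal_ne_zero.2 Real.pi_ne_zero
  field_simp [ofReal_ne_zero.2 hne]
  rw [I_sq, neg_neg]

variable {a} in
theorem rowScale_ne_zero (hN : 0 < N) (ha : a ≠ 0) (i : Fin 4) : rowScale N a n i ≠ 0 := by
  cases i using Fin.cases with
  | zero => exact one_ne_zero
  | succ l => exact left_ne_zero_of_mul_eq_one (cConst_mul n hN ha l)

end Rows

section Matrices

variable (N a : ℝ) (n : Fin 3 → ℕ) (z : ℂ) (v : Fin 4 → ℂ)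

theorem sum_coeffMatrix_zero_mul :
    ∑ k, coeffMatrix N a n z 0 k * v k = -z * v 0 + ∑ l, n l / N * v (Fin.succ l) := by
  have hrow (l : Fin 3) : coeffMatrix N a n z 0 l.succ = n l / N := by fin_cases l <;> rfl
  simp only [Fin.sum_univ_succ (n := 3), hrow]
  rfl

theorem sum_coeffMatrix_succ_mul (l : Fin 3) :
    ∑ k, coeffMatrix N a n z l.succ k * v k = -(v 0 + shift a l * v l.succ) := by
  fin_cases l <;> simp [Fin.sum_univ_succ, coeffMatrix, shift, add_comm]

theorem mul_jumpMatrix_apply_zero (M : Matrix (Fin 4) (Fin 4) ℂ) (x : ℝ) (i : Fin 4) :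
    (M * jumpMatrix N a x) i 0 = M i 0 := by
  simp [Matrix.mul_apply, Fin.sum_univ_succ, jumpMatrix]

theorem mul_jumpMatrix_apply_succ (M : Matrix (Fin 4) (Fin 4) ℂ) (x : ℝ) (i : Fin 4) (l : Fin 3) :
    (M * jumpMatrix N a x) i l.succ = M i l.succ + M i 0 * weight N a l x := by
  fin_cases l <;> simp [Matrix.mul_apply, Fin.sum_univ_succ, jumpMatrix, add_comm]

end Matrices

section Columns

variable {N : ℝ} (hN : 0 < N) (a : ℝ) (n : Fin 3 → ℕ)

/-- The linear functionals giving the four entries, up to scaling, of a row of the solution in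
terms of its polynomial: evaluation and the three Cauchy transforms. -/
def columnFunctional (z : ℂ) : Fin 4 → ℝ[X] →ₗ[ℝ] ℂ :=
  Fin.cons (aeval z).toLinearMap fun l => cauchyTransform hN (shift a l) z

/-- The exponential factors of the columns of `Psi`. -/
def expFactor (N a : ℝ) (z : ℂ) : Fin 4 → ℂ :=
  Fin.cons (exp (-N * (z ^ 2 / 2))) fun l => exp (-N * shift a l * z)

theorem columnFunctional_zero (z : ℂ) (P : ℝ[X]) : columnFunctional hN a z 0 P = aeval z P := rfl

theorem columnFunctional_succ (z : ℂ) (l : Fin 3) (P : ℝ[X]) :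
    columnFunctional hN a z l.succ P = cauchyTransform hN (shift a l) z P := rfl

theorem differentiableAt_columnFunctional (j : Fin 4) (P : ℝ[X]) {z : ℂ} (hz : z.im ≠ 0) :
    DifferentiableAt ℂ (fun w => columnFunctional hN a w j P) z := by
  cases j using Fin.cases with
  | zero => exact P.differentiableAt_aeval
  | succ l => exact (hasDerivAt_cauchyTransform hN (shift a l) P hz).differentiableAt

theorem hasDerivAt_columnFunctional_mul_expFactor (j : Fin 4) (P : ℝ[X]) {z : ℂ} (hz : z.im ≠ 0) :
    HasDerivAt (fun w => columnFunctional hN a w j P * expFactor N a w j)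
      (columnFunctional hN a z j (weightedDerivative N 0 P) * expFactor N a z j) z := by
  cases j using Fin.cases with
  | zero =>
    have hexp : HasDerivAt (fun w : ℂ => -N * (w ^ 2 / 2)) (-N * z) z :=
      (((hasDerivAt_pow 2 z).div_const 2).const_mul (-N : ℂ)).congr_deriv (by simp)
    refine ((P.hasDerivAt_aeval z).mul hexp.cexp).congr_deriv ?_
    simp only [columnFunctional_zero, expFactor, Fin.cons_zero, weightedDerivative, map_zero,
      sub_zero, map_sub, map_smul, map_mul, aeval_X, real_smul]
    ring
  | succ l =>
    have hexp : HasDerivAt (fun w : ℂ => -N * shift a l * w) (-N * shift a l) z :=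
      ((hasDerivAt_id z).const_mul _).congr_deriv (mul_one _)
    refine ((hasDerivAt_cauchyTransform hN (shift a l) P hz).mul hexp.cexp).congr_deriv ?_
    simp only [columnFunctional_succ, expFactor, Fin.cons_succ, weightedDerivative, map_zero,
      sub_zero, sub_mul, ← smul_eq_C_mul, map_sub, map_smul, real_smul]
    ring

theorem mul_columnFunctional_rowPoly_zero {n : Fin 3 → ℕ} (hn : ∀ l, 1 ≤ n l) (j : Fin 4) {z : ℂ}
    (hz : z.im ≠ 0) : z * columnFunctional hN a z j (rowPoly N a n 0) =
      columnFunctional hN a z j (X * rowPoly N a n 0) := by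
  cases j using Fin.cases with
  | zero => simp only [columnFunctional_zero, map_mul, aeval_X]
  | succ l =>
    have horth := gaussMoment_rowPoly_mul_X_pow (i := 0) a n hN (hn l)
    rw [pow_zero, mul_one] at horth
    rw [columnFunctional_succ, columnFunctional_succ, mul_cauchyTransform hN _ _ hz, horth,
      ofReal_zero, zero_div, mul_zero, add_zero]

theorem columnFunctional_weightedDerivative_rowPoly {n : Fin 3 → ℕ} (hn : ∀ l, 1 ≤ n l)
    (i j : Fin 4) {z : ℂ} (hz : z.im ≠ 0) :
    columnFunctional hN a z j (weightedDerivative N 0 (rowPoly N a n i)) =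
      N * ∑ k, coeffMatrix N a n z i k * columnFunctional hN a z j (rowPoly N a n k) := by
  have hN' : (N : ℂ) ≠ 0 := ofReal_ne_zero.2 hN.ne'
  cases i using Fin.cases with
  | zero =>
    have hmul := mul_columnFunctional_rowPoly_zero hN a hn j hz
    rw [sum_coeffMatrix_zero_mul, neg_mul, hmul, weightedDerivative, derivative_rowPoly_zero,
      map_zero, sub_zero, map_sub, map_sum, map_smul, real_smul, mul_add, Finset.mul_sum]
    simp only [map_nsmul]
    simp only [nsmul_eq_mul, ← mul_assoc, mul_div_cancel₀ _ hN']
    ring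
  | succ l =>
    rw [sum_coeffMatrix_succ_mul, weightedDerivative_rowPoly_succ a hN.ne' (hn l)]
    simp only [map_smul, map_add, real_smul, ofReal_neg]
    ring

/-- The solution of the Riemann-Hilbert problem. -/
def rhSolution (z : ℂ) : Matrix (Fin 4) (Fin 4) ℂ :=
  Matrix.of fun i j => rowScale N a n i * columnFunctional hN a z j (rowPoly N a n i)

theorem Psi_rhSolution {a : ℝ} (ha : a ≠ 0) (z : ℂ) (i j : Fin 4) :
    Psi N a n (rhSolution hN a n) z i j =
      columnFunctional hN a z j (rowPoly N a n i) * expFactor N a z j := by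
  have hleft : ![1, 1 / cConst N a n 0, 1 / cConst N a n 1, 1 / cConst N a n 2] i =
      (rowScale N a n i)⁻¹ := by
    simp only [one_div]
    fin_cases i
    exacts [inv_one.symm, rfl, rfl, rfl]
  have hright : ![exp (-N * (z ^ 2 / 2)), exp (-N * shift a 0 * z), exp (-N * shift a 1 * z),
      exp (-N * shift a 2 * z)] j = expFactor N a z j := by
    fin_cases j <;> rfl
  rw [Psi, Matrix.mul_diagonal, Matrix.diagonal_mul, hleft, hright, rhSolution, Matrix.of_apply,
    inv_mul_cancel_left₀ (rowScale_ne_zero n hN ha i)]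

theorem hasDerivAt_Psi_rhSolution {a : ℝ} (ha : a ≠ 0) {n : Fin 3 → ℕ} (hn : ∀ l, 1 ≤ n l) {z : ℂ}
    (hz : z.im ≠ 0) (i j : Fin 4) :
    HasDerivAt (fun w => Psi N a n (rhSolution hN a n) w i j)
      (((N : ℂ) • (coeffMatrix N a n z * Psi N a n (rhSolution hN a n) z)) i j) z := by
  simp only [Matrix.smul_apply, Matrix.mul_apply, Psi_rhSolution hN n ha, ← mul_assoc,
    ← Finset.sum_mul, smul_eq_mul, ← columnFunctional_weightedDerivative_rowPoly hN a hn i j hz]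
  exact hasDerivAt_columnFunctional_mul_expFactor hN a j _ hz

theorem tendsto_rhSolution {s : Set ℂ} {x : ℂ} {u : Fin 4 → Fin 3 → ℂ}
    (hu : ∀ i l, Tendsto (fun z => cauchyTransform hN (shift a l) z (rowPoly N a n i)) (𝓝[s] x)
      (𝓝 (u i l))) :
    Tendsto (rhSolution hN a n) (𝓝[s] x)
      (𝓝 (Matrix.of fun i j => rowScale N a n i *
        (Fin.cons (aeval x (rowPoly N a n i)) (u i) : Fin 4 → ℂ) j)) := by
  refine tendsto_pi_nhds.2 fun i => tendsto_pi_nhds.2 fun j => Tendsto.const_mul _ ?_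
  cases j using Fin.cases with
  | zero => exact ((rowPoly N a n i).continuous_aeval.tendsto x).mono_left nhdsWithin_le_nhds
  | succ l => exact hu i l

theorem rhSolution_jump (x : ℝ) : ∃ U V : Matrix (Fin 4) (Fin 4) ℂ,
    Tendsto (rhSolution hN a n) (𝓝[{z | 0 < z.im}] (x : ℂ)) (𝓝 U) ∧
    Tendsto (rhSolution hN a n) (𝓝[{z | z.im < 0}] (x : ℂ)) (𝓝 V) ∧
    U = V * jumpMatrix N a x := by
  refine ⟨_, _, tendsto_rhSolution hN a n fun i l => tendsto_cauchyTransform_upper hN _ _ x,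
    tendsto_rhSolution hN a n fun i l => tendsto_cauchyTransform_lower hN _ _ x, ?_⟩
  ext i j
  cases j using Fin.cases with
  | zero =>
    rw [mul_jumpMatrix_apply_zero]
    rfl
  | succ l =>
    have hweight : weight N a l x = gaussWeight N (shift a l) x := rfl
    simp only [mul_jumpMatrix_apply_succ, Matrix.of_apply, Fin.cons_succ, Fin.cons_zero, hweight,
      laplaceIntegral_Ioi_eq_neg_Iic_add]
    ring

end Columns

section Asymptotics

variable {N : ℝ} (hN : 0 < N) (a : ℝ) (n : Fin 3 → ℕ)

theorem rhSolution_mul_asymptoticDiagonal_zero (z : ℂ) (i : Fin 4) :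
    (rhSolution hN a n z * asymptoticDiagonal n z) i 0 =
      rowScale N a n i * (aeval z (rowPoly N a n i) * (z ^ ∑ l, n l)⁻¹) :=
  (Matrix.mul_diagonal ..).trans (mul_assoc ..)

theorem rhSolution_mul_asymptoticDiagonal_succ (z : ℂ) (i : Fin 4) (l : Fin 3) :
    (rhSolution hN a n z * asymptoticDiagonal n z) i l.succ =
      rowScale N a n i * (z ^ n l * cauchyTransform hN (shift a l) z (rowPoly N a n i)) := by
  have hentry : ![(z ^ ∑ l, n l)⁻¹, z ^ n 0, z ^ n 1, z ^ n 2] l.succ = z ^ n l := by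
    fin_cases l <;> rfl
  rw [asymptoticDiagonal, Matrix.mul_diagonal, hentry, rhSolution, Matrix.of_apply,
    columnFunctional_succ, mul_assoc, mul_comm (z ^ n l)]

theorem coeff_rowPoly {n : Fin 3 → ℕ} (hn : ∀ l, 1 ≤ n l) (i : Fin 4) :
    (rowPoly N a n i).coeff (∑ l, n l) = if i = 0 then 1 else 0 := by
  cases i using Fin.cases with
  | zero =>
    rw [if_pos rfl, ← natDegree_rowPoly_zero N a]
    exact monic_multiHermite N (shift a) n
  | succ l =>
    rw [if_neg l.succ_ne_zero, coeff_eq_zero_of_natDegree_lt (natDegree_rowPoly_succ_lt N a (hn l))]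

theorem rhSolution_asymptotics_zero {n : Fin 3 → ℕ} (hn : ∀ l, 1 ≤ n l) (i : Fin 4) :
    (fun z => (rhSolution hN a n z * asymptoticDiagonal n z - 1) i 0)
      =O[offRealAtInfinity] fun z => z⁻¹ := by
  have hdeg : (rowPoly N a n i).natDegree ≤ ∑ l, n l := by
    cases i using Fin.cases with
    | zero => exact (natDegree_rowPoly_zero N a n).le
    | succ l => exact (natDegree_rowPoly_succ_lt N a (hn l)).le
  refine (((aeval_mul_inv_pow_sub_coeff_isBigO hdeg).mono inf_le_left).const_mul_left
    (rowScale N a n i)).congr_left fun z => ?_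
  rw [Matrix.sub_apply, rhSolution_mul_asymptoticDiagonal_zero, mul_sub, coeff_rowPoly a hn]
  congr 1
  cases i using Fin.cases with
  | zero => simp [rowScale]
  | succ l => simp

theorem rhSolution_asymptotics_of_ne {i : Fin 4} {l : Fin 3} (h : i ≠ l.succ) :
    (fun z => (rhSolution hN a n z * asymptoticDiagonal n z - 1) i l.succ)
      =O[offRealAtInfinity] fun z => z⁻¹ := by
  have horth : ∀ m < n l, gaussMoment hN (shift a l) (rowPoly N a n i * X ^ m) = 0 := fun m hm =>
    gaussMoment_rowPoly_mul_X_pow a n hN (hm.trans_eq (rowIndex_of_ne n h).symm)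
  refine ((pow_mul_cauchyTransform_isBigO hN _ horth).const_mul_left
    (rowScale N a n i)).congr_left fun z => ?_
  rw [Matrix.sub_apply, rhSolution_mul_asymptoticDiagonal_succ, Matrix.one_apply_ne h, sub_zero]

theorem rhSolution_asymptotics_succ_self {a : ℝ} (ha : a ≠ 0) {n : Fin 3 → ℕ} {l : Fin 3}
    (hl : 1 ≤ n l) :
    (fun z => (rhSolution hN a n z * asymptoticDiagonal n z - 1) l.succ l.succ)
      =O[offRealAtInfinity] fun z => z⁻¹ := by
  have horth : ∀ m < n l - 1, gaussMoment hN (shift a l) (rowPoly N a n l.succ * X ^ m) = 0 :=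
    fun m hm => gaussMoment_rowPoly_mul_X_pow a n hN (hm.trans_eq (rowIndex_succ_self n l).symm)
  refine ((pow_succ_mul_cauchyTransform_sub_isBigO hN _ horth).const_mul_left
    (cConst N a n l)).congr_left fun z => ?_
  rw [Matrix.sub_apply, rhSolution_mul_asymptoticDiagonal_succ, Matrix.one_apply_eq, mul_sub,
    cConst_mul n hN ha l, Nat.sub_add_cancel hl]
  rfl

theorem isRHSolution_rhSolution {a : ℝ} (ha : a ≠ 0) {n : Fin 3 → ℕ} (hn : ∀ l, 1 ≤ n l) :
    IsRHSolution N a n (rhSolution hN a n) where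
  analytic i j z hz := ((differentiableAt_columnFunctional hN a j (rowPoly N a n i)
    hz).const_mul _).differentiableWithinAt
  jump := rhSolution_jump hN a n
  asymptotics i j := by
    cases j using Fin.cases with
    | zero => exact rhSolution_asymptotics_zero hN a hn i
    | succ l =>
      obtain rfl | h := eq_or_ne i l.succ
      · exact rhSolution_asymptotics_succ_self hN ha (hn l)
      · exact rhSolution_asymptotics_of_ne hN a n h

end Asymptotics

end

end MultipleHermite

theorem mainTheorem4 (N a : ℝ) (hN : 0 < N) (ha : a ≠ 0) (n : Fin 3 → ℕ) (hn : ∀ j, 1 ≤ n j) :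
    ∃ Y : ℂ → Matrix (Fin 4) (Fin 4) ℂ,
      MultipleHermite.IsRHSolution N a n Y ∧
      (∀ Y' : ℂ → Matrix (Fin 4) (Fin 4) ℂ, MultipleHermite.IsRHSolution N a n Y' →
        ∀ z : ℂ, z.im ≠ 0 → Y' z = Y z) ∧
      ∀ z : ℂ, z.im ≠ 0 → ∀ i j : Fin 4,
        HasDerivAt (fun w : ℂ => MultipleHermite.Psi N a n Y w i j)
          (((N : ℂ) • (MultipleHermite.coeffMatrix N a n z * MultipleHermite.Psi N a n Y z)) i j)
          z :=
  have h := MultipleHermite.isRHSolution_rhSolution hN ha hn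
  ⟨_, h, fun _ h' _ hz => h.eq h' hz,
    fun _ hz i j => MultipleHermite.hasDerivAt_Psi_rhSolution hN ha hn hz i j⟩
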